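/- **Gain graphs.** Let $G$ be a group. A gain graph $\Gamma$ with gain group $G$ consists of a finite vertex set $V_\Gamma$, a set $L_\Gamma\subseteq V_\Gamma$ of loops, and a finite set $E_\Gamma$ of edges $\{u,v\}_g$ with $u\ne v$ in $V_\Gamma$ and $g\in G$, where $\{u,v\}_g=\{v,u\}_{g^{-1}}$. It is loopless if $L_\Gamma=\varnothing$, and connected if any two vertices are joined by a path of edges. For $W\subseteq V_\Gamma$, the induced subgraph $\Gamma[W]$ has vertex set $W$, loop set $W\cap L_\Gamma$, and all edges $\{u,v\}_g\in E_\Gamma$ with $u,v\in W$; and $\Gamma\setminus v:=\Gamma[V_\Gamma\setminus\{v\}]$. Isomorphism means relabelling of the vertices. For a finite subgroup $H\subseteq G$, $K_n^{H}$ is the loopless gain graph on $\{1,\dots,n\}$ with all edges $\{i,j\}_g$, $i\neq j$, $g\in H$. For finite $G$, $\mathring K_n^{G}$ is $K_n^G$ with a loop added at every vertex (for $n=0$ this is the null graph, which has no vertices). A vertex $v$ of $\Gamma$ is *bias simplicial* if (a) $\{u,v\}_g,\{v,w\}_h\in E_\Gamma$ with $u\neq w$ implies $\{u,w\}_{gh}\in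 E_\Gamma$; (b) $\{u,v\}_g,\{u,v\}_h\in E_\Gamma$ with $g\ne h$ implies $u\in L_\Gamma$; (c) $\{u,v\}_g\in E_\Gamma$ and $v\in L_\Gamma$ imply $u\in L_\Gamma$. A simple graph is *chordal* if every cycle of length at least $4$ has a chord. **Arrangements.** A central arrangement $\mathcal A$ in a finite-dimensional vector space is a finite set of subspaces of codimension $1$. Its matroid $M(\mathcal A)$ has ground set $\mathcal A$, a subset being independent if the codimension of its intersection equals its cardinality. For a matroid $M$ on a finite ground set with rank function $r$, put $\chi(M,t)=\sum_{X}\mu(X)\,t^{r(M)-r(X)}$, the sum being over all flats $X$, where $\mu(X)$ is the value of the Möbius function of the lattice of flats on the interval from its least element to $X$. A *divisional flag* of a simple matroid $M$ of rank $n$ on $E$ is a chain of flats $\varnothing=X_0\subseteq X_1\subseteq\dots\subseteq X_n=E$ with $r(X_i)=i$ for $0\le i\le n$ and such that $\chi(M/X_{i+1},t)$ divides $\chi(M/X_i,t)$ in $\mathbb Z[t]$ for $0\le i<n$. The arrangement $\mathcal A$ is *divisionally free* if $M(\mathcal A)$ has a divisional flag. If $G$ is a finite subgroup of the multiplicative group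 $\mathbb K^\times$ of a field $\mathbb K$ and $\Gamma$ is a gain graph with gain group $G$, then $\mathcal A_\times(\Gamma)$ is the arrangement in $\mathbb K^{V_\Gamma}$ consisting of the hyperplanes $\{x_u-g x_v=0\}$ for $\{u,v\}_g\in E_\Gamma$ and $\{x_u=0\}$ for $u\in L_\Gamma$. **Theorem.** Let $G$ be a finite subgroup of the multiplicative group of a field $\mathbb K$, and let $\mathcal C^G_\times$ be the smallest class of gain graphs with gain group $G$, closed under isomorphism, that satisfies the following conditions. 1. The null graph belongs to $\mathcal C^G_\times$. 2. $K_2^G\in\mathcal C^G_\times$. 3. If $\{\pm1\}\subseteq G$, then $K_3^{\{\pm1\}}\in\mathcal C^G_\times$. 4. If $\{\pm1\}\subseteq G$, then $\mathcal C^G_\times$ contains every connected loopless gain graph with all gains in $\{\pm1\}$ such that the positive edges (those of gain $1$) form a chordal graph, the negative edges (those of gain $-1$) form a star $\{u,v_1\}_{-1},\dots,\{u,v_r\}_{-1}$, and any two distinct vertices among $v_1,\dots,v_r$ are joined by a positive edge. 5. If $\Gamma$ has a bias-simplicial vertex $v$ and $\Gamma\setminus v\in\mathcal C^G_\times$, then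 $\Gamma\in\mathcal C^G_\times$. 6. If $V_\Gamma=V_1\cup V_2$ with $\Gamma[V_1],\Gamma[V_2]\in\mathcal C^G_\times$, $E_\Gamma=E_{\Gamma[V_1]}\cup E_{\Gamma[V_2]}$, and $\Gamma[V_1\cap V_2]\simeq\mathring K_n^G$ for some $n\ge0$, then $\Gamma\in\mathcal C^G_\times$. Then for every $\Gamma\in\mathcal C^G_\times$ the arrangement $\mathcal A_\times(\Gamma)$ is divisionally free. -/

import Mathlib

universe u v w

/-! ### Gain graphs -/

/-- A gain graph on the vertex set `V` with gain group `G`.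
`Γ.Edge u v g` says that `{u,v}_g` is an edge; the identification `{u,v}_g = {v,u}_{g⁻¹}`
is the field `symm`. The set of loops is a set of vertices. (The vertex sets and gain groups
used below are finite, so that there are only finitely many edges.) -/
@[ext]
structure GainGraph (V : Type u) (G : Type v) [Group G] where
  Edge : V → V → G → Prop
  symm : ∀ {u v : V} {g : G}, Edge u v g → Edge v u g⁻¹
  irrefl : ∀ (u : V) (g : G), ¬ Edge u u g
  Loops : Set V

namespace GainGraph

variable {V : Type u} {W : Type w} {G : Type v} [Group G]

/-- The induced subgraph `Γ[S]`. -/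
def induce (Γ : GainGraph V G) (S : Set V) : GainGraph S G where
  Edge a b g := Γ.Edge a b g
  symm h := Γ.symm h
  irrefl a g := Γ.irrefl a g
  Loops := {a | (a : V) ∈ Γ.Loops}

/-- Isomorphism of gain graphs with the same gain group: a relabelling of the vertices. -/
def IsIso (Γ : GainGraph V G) (Δ : GainGraph W G) : Prop :=
  ∃ φ : V ≃ W, (∀ a b g, Γ.Edge a b g ↔ Δ.Edge (φ a) (φ b) g) ∧
    ∀ a, a ∈ Γ.Loops ↔ φ a ∈ Δ.Loops

/-- `K_n^H`, for a subgroup `H` of the gain group, as a gain graph with gain group `G`. -/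
def complete (n : ℕ) (H : Subgroup G) : GainGraph (Fin n) G where
  Edge i j g := i ≠ j ∧ g ∈ H
  symm h := ⟨h.1.symm, H.inv_mem h.2⟩
  irrefl _ _ h := h.1 rfl
  Loops := ∅

/-- `K_n^G` together with all possible loops. -/
def completeWithLoops (n : ℕ) (G : Type v) [Group G] : GainGraph (Fin n) G where
  Edge i j _ := i ≠ j
  symm h := h.symm
  irrefl _ _ h := h rfl
  Loops := Set.univ

/-- Bias-simplicial vertices. -/
structure IsBiasSimplicial (Γ : GainGraph V G) (v : V) : Prop where
  triangle : ∀ {u w : V} {g h : G}, u ≠ w → Γ.Edge u v g → Γ.Edge v w h → Γ.Edge u w (g * h)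
  parallel : ∀ {u : V} {g h : G}, Γ.Edge u v g → Γ.Edge u v h → g ≠ h → u ∈ Γ.Loops
  loop : ∀ {u : V} {g : G}, Γ.Edge u v g → v ∈ Γ.Loops → u ∈ Γ.Loops

/-- The underlying simple graph: two distinct vertices are adjacent if some edge joins them. -/
def underlying (Γ : GainGraph V G) : SimpleGraph V where
  Adj a b := ∃ g, Γ.Edge a b g
  symm := ⟨fun _ _ ⟨g, h⟩ => ⟨g⁻¹, Γ.symm h⟩⟩
  loopless := ⟨fun a ⟨g, h⟩ => Γ.irrefl a g h⟩

/-- The simple graph formed by the edges with trivial gain. -/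
def positivePart (Γ : GainGraph V G) : SimpleGraph V where
  Adj a b := Γ.Edge a b 1
  symm := ⟨fun _ _ h => by simpa using Γ.symm h⟩
  loopless := ⟨fun a h => Γ.irrefl a 1 h⟩

end GainGraph

/-- A simple graph is chordal if every cycle of length at least four has a chord: an edge that joins
two vertices of the cycle and is not an edge of the cycle. -/
def SimpleGraph.IsChordalGraph {V : Type u} (G : SimpleGraph V) : Prop :=
  ∀ (a : V) (p : G.Walk a a), p.IsCycle → 4 ≤ p.length →
    ∃ x ∈ p.support, ∃ y ∈ p.support, G.Adj x y ∧ s(x, y) ∉ p.edges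

/-- The subgroup `{1, -1}` of the multiplicative group of a field. -/
def signSubgroup (K : Type v) [Field K] : Subgroup Kˣ where
  carrier := {1, -1}
  one_mem' := by simp
  mul_mem' := by
    rintro a b (rfl | rfl) (rfl | rfl) <;> simp
  inv_mem' := by
    rintro a (rfl | rfl) <;> simp

/-- Let `G` be a subgroup of `Kˣ` containing `-1`. The connected loopless gain graphs `Γ`
with gains in `{1, -1}` whose positive edges form a chordal graph and whose negative edges are
`{c, s}_{-1}` for `s` in a set `S` of vertices different from `c`, where any two distinct
elements of `S` are joined by a positive edge. -/
structure GainGraph.IsChordalWithNegativeStar {V : Type u} {K : Type v} [Field K]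
    {G : Subgroup Kˣ} (hG : signSubgroup K ≤ G) (Γ : GainGraph V G) : Prop where
  connected : Γ.underlying.Connected
  loopless : Γ.Loops = ∅
  gain_mem : ∀ a b (g : G), Γ.Edge a b g → (g : Kˣ) ∈ signSubgroup K
  chordal : Γ.positivePart.IsChordalGraph
  star : ∃ (c : V) (S : Set V), c ∉ S ∧
    (∀ a b, Γ.Edge a b ⟨-1, hG (Or.inr rfl)⟩ ↔ (a = c ∧ b ∈ S) ∨ (b = c ∧ a ∈ S)) ∧
    ∀ a ∈ S, ∀ b ∈ S, a ≠ b → Γ.Edge a b 1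

/-- The smallest class of finite gain graphs with gain group `G ≤ Kˣ` that satisfies the six listed
conditions. Being an inductive predicate makes it the smallest such class. -/
inductive FrameClass {K : Type v} [Field K] (G : Subgroup Kˣ) :
    ∀ {V : Type u} [Finite V], GainGraph V G → Prop
  | null {V : Type u} [Finite V] [IsEmpty V] (Γ : GainGraph V G) : FrameClass G Γ
  | completeTwo {V : Type u} [Finite V] (Γ : GainGraph V G)
      (h : Γ.IsIso (GainGraph.complete 2 (⊤ : Subgroup G))) : FrameClass G Γ
  | signedCompleteThree {V : Type u} [Finite V] (_ : signSubgroup K ≤ G) (Γ : GainGraph V G)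
      (h : Γ.IsIso (GainGraph.complete 3 ((signSubgroup K).subgroupOf G))) : FrameClass G Γ
  | chordalWithNegativeStar {V : Type u} [Finite V] (hG : signSubgroup K ≤ G)
      (Γ : GainGraph V G) (h : Γ.IsChordalWithNegativeStar hG) : FrameClass G Γ
  | biasSimplicial {V : Type u} [Finite V] (Γ : GainGraph V G) (v : V)
      (hv : Γ.IsBiasSimplicial v) (h : FrameClass G (Γ.induce {v}ᶜ)) : FrameClass G Γ
  | glue {V : Type u} [Finite V] (Γ : GainGraph V G) (V₁ V₂ : Set V) (n : ℕ)
      (hV : V₁ ∪ V₂ = Set.univ)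
      (h₁ : FrameClass G (Γ.induce V₁)) (h₂ : FrameClass G (Γ.induce V₂))
      (hE : ∀ a b g, Γ.Edge a b g → (a ∈ V₁ ∧ b ∈ V₁) ∨ (a ∈ V₂ ∧ b ∈ V₂))
      (hn : (Γ.induce (V₁ ∩ V₂)).IsIso (GainGraph.completeWithLoops n G)) : FrameClass G Γ

/-! ### Characteristic polynomials and divisional flags of matroids -/

namespace Matroid

variable {α : Type u}

/-- The flats of `M`, ordered by inclusion. -/
abbrev FlatType (M : Matroid α) : Type u := {F : Set α // M.IsFlat F}

instance finite_flatType (M : Matroid α) [M.Finite] : Finite M.FlatType :=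
  (M.ground_finite.finite_subsets.subset fun _ hF => hF.subset_ground).to_subtype

/-- The rank of a subset, as a natural number. -/
noncomputable def natRk (M : Matroid α) (X : Set α) : ℕ := (M.eRk X).toNat

/-- The value `μ(F)` at the flat `F` of the one-variable Möbius function of the lattice of flats. -/
noncomputable def flatMoebius (M : Matroid α) [M.Finite] (F : M.FlatType) : ℤ :=
  letI := Fintype.ofFinite M.FlatType
  letI := Classical.decEq M.FlatType
  letI : DecidableLE M.FlatType := Classical.decRel _
  letI : DecidableLT M.FlatType := Classical.decRel _
  letI : LocallyFiniteOrder M.FlatType := Fintype.toLocallyFiniteOrder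
  IncidenceAlgebra.mu ℤ (⟨M.closure ∅, M.isFlat_closure ∅⟩ : M.FlatType) F

/-- The characteristic polynomial `χ(M, t) = ∑_F μ(F) t^{r(M) - r(F)}`, over all flats `F`. -/
noncomputable def charPoly (M : Matroid α) [M.Finite] : Polynomial ℤ :=
  letI := Fintype.ofFinite M.FlatType
  ∑ F : M.FlatType,
    Polynomial.C (M.flatMoebius F) * Polynomial.X ^ (M.natRk M.E - M.natRk F.1)

/-- `M` has a divisional flag `∅ = X₀ ⊆ X₁ ⊆ ⋯ ⊆ Xₙ = E`, where `n` is the rank of `M`. -/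
def HasDivisionalFlag (M : Matroid α) [M.Finite] : Prop :=
  ∃ X : ℕ → Set α,
    X 0 = ∅ ∧ X (M.natRk M.E) = M.E ∧
    (∀ i ≤ M.natRk M.E, M.IsFlat (X i) ∧ M.natRk (X i) = i) ∧
    ∀ i < M.natRk M.E, X i ⊆ X (i + 1) ∧ (M ／ X (i + 1)).charPoly ∣ (M ／ X i).charPoly

end Matroid

/-! ### Hyperplane arrangements -/

section Arrangement

variable {K : Type v} [Field K] {E : Type u} [AddCommGroup E] [Module K E]

/-- The codimension of a subspace. -/
noncomputable def Submodule.codim (P : Submodule K E) : ℕ := Module.finrank K (E ⧸ P)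

variable (K E) in
/-- A central hyperplane arrangement: a finite set of subspaces of codimension one. -/
structure HyperplaneArrangement where
  hyperplanes : Set (Submodule K E)
  finite : hyperplanes.Finite
  codim_eq_one : ∀ H ∈ hyperplanes, H.codim = 1

variable [FiniteDimensional K E]

theorem Submodule.codim_add_finrank (P : Submodule K E) :
    P.codim + Module.finrank K P = Module.finrank K E :=
  P.finrank_quotient_add_finrank

theorem Submodule.codim_anti {P Q : Submodule K E} (h : P ≤ Q) : Q.codim ≤ P.codim := by
  have := P.codim_add_finrank
  have := Q.codim_add_finrank
  have := Submodule.finrank_mono h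
  omega

theorem Submodule.codim_strictAnti {P Q : Submodule K E} (h : P < Q) : Q.codim < P.codim := by
  have := P.codim_add_finrank
  have := Q.codim_add_finrank
  have := Submodule.finrank_lt_finrank_of_lt h
  omega

theorem Submodule.codim_inf_le (P Q : Submodule K E) : (P ⊓ Q).codim ≤ P.codim + Q.codim := by
  have := P.codim_add_finrank
  have := Q.codim_add_finrank
  have := (P ⊓ Q).codim_add_finrank
  have := Submodule.finrank_sup_add_finrank_inf_eq P Q
  have := Submodule.finrank_le (P ⊔ Q)
  omega

namespace HyperplaneArrangement

theorem codim_sInf_union_le (A : HyperplaneArrangement K E) (I J : Set (Submodule K E))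
    (hJ : J ⊆ A.hyperplanes) : (sInf (I ∪ J)).codim ≤ (sInf I).codim + J.ncard := by
  have hfin : J.Finite := A.finite.subset hJ
  induction J, hfin using Set.Finite.induction_on with
  | empty => simp
  | @insert H J hH hfin ih =>
    have h1 := ih ((Set.subset_insert _ _).trans hJ)
    have h2 := A.codim_eq_one H (hJ (Set.mem_insert _ _))
    rw [Set.union_insert, sInf_insert, Set.ncard_insert_of_notMem hH hfin]
    have h3 := Submodule.codim_inf_le H (sInf (I ∪ J))
    omega

theorem codim_sInf_le (A : HyperplaneArrangement K E) (J : Set (Submodule K E))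
    (hJ : J ⊆ A.hyperplanes) : (sInf J).codim ≤ J.ncard := by
  have h := A.codim_sInf_union_le ∅ J hJ
  have h0 := (⊤ : Submodule K E).codim_add_finrank
  rw [finrank_top] at h0
  rw [Set.empty_union, sInf_empty] at h
  omega

/-- The linear dependence matroid `M(A)` on the set of hyperplanes of `A`: a set of hyperplanes is
independent if the codimension of its intersection equals its cardinality. -/
noncomputable def matroid (A : HyperplaneArrangement K E) : Matroid (Submodule K E) :=
  (IndepMatroid.ofFinite A.finite
    (fun B => B ⊆ A.hyperplanes ∧ (sInf B).codim = B.ncard)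
    (by
      refine ⟨Set.empty_subset _, ?_⟩
      have h0 := (⊤ : Submodule K E).codim_add_finrank
      rw [finrank_top] at h0
      rw [sInf_empty, Set.ncard_empty]
      omega)
    (by
      rintro I J ⟨hJ, hc⟩ hIJ
      refine ⟨hIJ.trans hJ, le_antisymm (A.codim_sInf_le I (hIJ.trans hJ)) ?_⟩
      have h1 := A.codim_sInf_union_le I (J \ I) (Set.sdiff_subset.trans hJ)
      rw [Set.union_sdiff_cancel hIJ] at h1
      have h2 := Set.ncard_sdiff_add_ncard_of_subset hIJ (A.finite.subset hJ)
      omega)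
    (by
      rintro I J ⟨hI, hcI⟩ ⟨hJ, hcJ⟩ hlt
      have hex : ∃ H ∈ J, ¬ sInf I ≤ H := by
        by_contra! hcon
        have := Submodule.codim_anti (le_sInf hcon)
        omega
      obtain ⟨H, hHJ, hH⟩ := hex
      have hHI : H ∉ I := fun h => hH (sInf_le h)
      refine ⟨H, hHJ, hHI, Set.insert_subset (hJ hHJ) hI, ?_⟩
      apply le_antisymm (A.codim_sInf_le _ (Set.insert_subset (hJ hHJ) hI))
      rw [Set.ncard_insert_of_notMem hHI (A.finite.subset hI), sInf_insert]
      have := Submodule.codim_strictAnti (inf_lt_right.2 hH)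
      omega)
    (fun _ h => h.1)).matroid

instance finite_matroid (A : HyperplaneArrangement K E) : A.matroid.Finite := ⟨A.finite⟩

/-- `A` is divisionally free if `M(A)` has a divisional flag. -/
def IsDivisionallyFree (A : HyperplaneArrangement K E) : Prop := A.matroid.HasDivisionalFlag

end HyperplaneArrangement

theorem LinearMap.codim_ker_eq_one (φ : E →ₗ[K] K) (h : φ ≠ 0) :
    (LinearMap.ker φ).codim = 1 := by
  have h1 := (LinearMap.ker φ).codim_add_finrank
  have h2 := LinearMap.finrank_range_add_finrank_ker φ
  rw [LinearMap.range_eq_top.2 (LinearMap.surjective h), finrank_top, Module.finrank_self] at h2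
  omega

end Arrangement

namespace GainGraph

variable {V : Type u} {K : Type v} [Field K] {G : Subgroup Kˣ}

/-- The linear form `x_a - g x_b` on `K^V`. -/
def edgeForm (a b : V) (g : Kˣ) : (V → K) →ₗ[K] K :=
  LinearMap.proj a - (g : K) • LinearMap.proj b

/-- The hyperplanes `x_a = g x_b` for the edges `{a,b}_g` and `x_a = 0` for the loops `a`. -/
def frameHyperplanes (Γ : GainGraph V G) : Set (Submodule K (V → K)) :=
  {H | ∃ (a b : V) (g : G), Γ.Edge a b g ∧ H = LinearMap.ker (edgeForm a b (g : Kˣ))} ∪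
    {H | ∃ a ∈ Γ.Loops, H = LinearMap.ker (LinearMap.proj a : (V → K) →ₗ[K] K)}

theorem finite_frameHyperplanes [Finite V] [Finite G] (Γ : GainGraph V G) :
    Γ.frameHyperplanes.Finite := by
  refine Set.Finite.union ?_ ?_
  · refine (Set.finite_range fun t : V × V × G =>
      LinearMap.ker (edgeForm (K := K) t.1 t.2.1 (t.2.2 : Kˣ))).subset ?_
    rintro H ⟨a, b, g, -, rfl⟩
    exact ⟨(a, b, g), rfl⟩
  · refine (Set.finite_range fun a : V =>
      LinearMap.ker (LinearMap.proj a : (V → K) →ₗ[K] K)).subset ?_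
    rintro H ⟨a, -, rfl⟩
    exact ⟨a, rfl⟩

/-- The arrangement `A_×(Γ)` in `K^V`. -/
def frameArrangement [Finite V] [Finite G] (Γ : GainGraph V G) :
    HyperplaneArrangement K (V → K) where
  hyperplanes := Γ.frameHyperplanes
  finite := Γ.finite_frameHyperplanes
  codim_eq_one := by
    classical
    rintro H (⟨a, b, g, hab, rfl⟩ | ⟨a, -, rfl⟩)
    · have hne : a ≠ b := by
        rintro rfl
        exact Γ.irrefl a g hab
      refine LinearMap.codim_ker_eq_one _ fun h => ?_
      have := LinearMap.congr_fun h (Pi.single a 1)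
      simp [edgeForm, Pi.single_eq_of_ne hne.symm] at this
    · refine LinearMap.codim_ker_eq_one _ fun h => ?_
      have := LinearMap.congr_fun h (Pi.single a 1)
      simp at this

end GainGraph

/-!
Regard flats as subspaces, and let `T` be the least one. If `X` is a modular flat of dimension one
over `T` and the hyperplane `e` of the arrangement is a complement of `X` over `T`, then for all
flats `Y ≥ X` the intervals `[T, e ⊓ Y]` and `[X, Y]` have the same characteristic polynomial, and
it divides that of `[T, Y]`. So `Y ↦ e ⊓ Y` turns a divisional flag of the interval `[X, ⊤]` into
one of `[T, e]`, which extends to `[T, ⊤]`. This settles a bias simplicial vertex `v`, where `X` is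
the intersection of the hyperplanes that do not involve `v`.

When `Γ` is glued from two parts along a full clique `W` (all edges and loops present), flags of the
parts can be concatenated once one of them passes through a complement of the subspace of vectors
vanishing on `W`. The induction therefore produces such a flag for every full clique.
-/

/-! ### Relative characteristic polynomials -/

open Polynomial Classical in
/-- The characteristic polynomial of the part of a finite subset `S` of a poset between `T` and `P`,
for a grading `d` that plays the role of the dimension. It is defined by Möbius inversion, as the
solution of `∑ Q ∈ S with T ≤ Q ∧ Q ≤ P, relCharPoly S d T Q = X ^ (d P - d T)`. For the
intersections of hyperplanes, ordered by inclusion, these are the characteristic polynomials of the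
minors of the matroid. -/
noncomputable def relCharPoly {α : Type*} [PartialOrder α] [WellFoundedLT α] (S : Finset α)
    (d : α → ℕ) (T : α) : α → ℤ[X] :=
  (wellFounded_lt (α := α)).fix fun P rec => X ^ (d P - d T) -
    ∑ Q ∈ (S.filter fun Q => T ≤ Q ∧ Q < P).attach, rec Q.1 (Finset.mem_filter.1 Q.2).2.2

section RelCharPoly

open Polynomial
open scoped Classical

theorem sum_filter_Icc_eq_add_sum_filter_Ico {α R : Type*} [PartialOrder α] [AddCommMonoid R]
    {S : Finset α} {T P : α} (f : α → R) (hP : P ∈ S) (hT : T ≤ P) :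
    ∑ Q ∈ S with T ≤ Q ∧ Q ≤ P, f Q = f P + ∑ Q ∈ S with T ≤ Q ∧ Q < P, f Q := by
  rw [← Finset.sum_insert (by simp)]
  refine Finset.sum_congr ?_ fun _ _ => rfl
  ext Q
  simp only [Finset.mem_filter, Finset.mem_insert, le_iff_eq_or_lt (b := P)]
  constructor
  · tauto
  · rintro (rfl | h)
    · exact ⟨hP, hT, Or.inl rfl⟩
    · tauto

variable {α : Type*} [PartialOrder α] [WellFoundedLT α] {S : Finset α} {d : α → ℕ} {T P : α}

theorem relCharPoly_eq_sub (S : Finset α) (d : α → ℕ) (T P : α) :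
    relCharPoly S d T P =
      X ^ (d P - d T) - ∑ Q ∈ S with T ≤ Q ∧ Q < P, relCharPoly S d T Q := by
  rw [relCharPoly, WellFounded.fix_eq]
  congr 1
  exact Finset.sum_attach (S.filter fun Q => T ≤ Q ∧ Q < P) (relCharPoly S d T)

theorem sum_relCharPoly (hP : P ∈ S) (hT : T ≤ P) :
    ∑ Q ∈ S with T ≤ Q ∧ Q ≤ P, relCharPoly S d T Q = X ^ (d P - d T) := by
  rw [sum_filter_Icc_eq_add_sum_filter_Ico _ hP hT, relCharPoly_eq_sub S d T P, sub_add_cancel]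

theorem eq_mul_relCharPoly_of_sum_eq {f : α → ℤ[X]} {c : ℤ[X]} {B : α}
    (hf : ∀ P ∈ S, T ≤ P → P ≤ B →
      ∑ Q ∈ S with T ≤ Q ∧ Q ≤ P, f Q = c * X ^ (d P - d T)) :
    ∀ P ∈ S, T ≤ P → P ≤ B → f P = c * relCharPoly S d T P := by
  intro P
  induction P using WellFoundedLT.induction with
  | ind P ih =>
    intro hP hT hB
    have hsum := hf P hP hT hB
    have hlt : ∑ Q ∈ S with T ≤ Q ∧ Q < P, f Q
        = ∑ Q ∈ S with T ≤ Q ∧ Q < P, c * relCharPoly S d T Q :=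
      Finset.sum_congr rfl fun Q hQ => by
        obtain ⟨hQS, hTQ, hQP⟩ := Finset.mem_filter.1 hQ
        exact ih Q hQP hQS hTQ (hQP.le.trans hB)
    rw [← sum_relCharPoly (d := d) hP hT, Finset.mul_sum,
      sum_filter_Icc_eq_add_sum_filter_Ico _ hP hT, sum_filter_Icc_eq_add_sum_filter_Ico _ hP hT,
      hlt] at hsum
    exact add_right_cancel hsum

theorem natDegree_relCharPoly_le (hd : StrictMono d) (T P : α) :
    (relCharPoly S d T P).natDegree ≤ d P - d T := by
  induction P using WellFoundedLT.induction with
  | ind P ih =>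
    rw [relCharPoly_eq_sub]
    refine (natDegree_sub_le _ _).trans (max_le (natDegree_X_pow_le _) ?_)
    refine natDegree_sum_le_of_forall_le _ _ fun Q hQ => ?_
    have hQP := (Finset.mem_filter.1 hQ).2.2
    exact (ih Q hQP).trans (Nat.sub_le_sub_right (hd hQP).le _)

theorem relCharPoly_ne_zero (hd : StrictMono d) (T P : α) : relCharPoly S d T P ≠ 0 := by
  suffices h : (relCharPoly S d T P).coeff (d P - d T) = 1 by
    intro h0
    simp [h0] at h
  rw [relCharPoly_eq_sub, coeff_sub, coeff_X_pow_self, finsetSum_coeff, Finset.sum_eq_zero,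
    sub_zero]
  intro Q hQ
  obtain ⟨-, hTQ, hQP⟩ := Finset.mem_filter.1 hQ
  refine coeff_eq_zero_of_natDegree_lt ((natDegree_relCharPoly_le hd T Q).trans_lt ?_)
  have := hd hQP
  have := hd.monotone hTQ
  omega

theorem relCharPoly_map {β : Type*} [PartialOrder β] [WellFoundedLT β] {S' : Finset β}
    {d' : β → ℕ} {c : ℕ} (ι : α ↪o β) (hd : ∀ P, d' (ι P) = d P + c)
    (hS : ∀ P ∈ S, ι P ∈ S') (hS' : ∀ Q ∈ S', ι T ≤ Q → ∃ P ∈ S, ι P = Q) (hP : P ∈ S)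
    (hT : T ≤ P) : relCharPoly S' d' (ι T) (ι P) = relCharPoly S d T P := by
  rw [← one_mul (relCharPoly S d T P)]
  refine eq_mul_relCharPoly_of_sum_eq (B := P) (f := fun P => relCharPoly S' d' (ι T) (ι P))
    (fun P hP hT _ => ?_) P hP hT le_rfl
  have hexp : d P - d T = d' (ι P) - d' (ι T) := by rw [hd, hd, Nat.add_sub_add_right]
  rw [one_mul, hexp, ← sum_relCharPoly (hS P hP) (ι.monotone hT)]
  refine Finset.sum_bij (fun Q _ => ι Q) (fun Q hQ => ?_) (fun _ _ _ _ h => ι.injective h)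
    (fun Q hQ => ?_) fun _ _ => rfl
  · simp only [Finset.mem_filter, ι.le_iff_le] at hQ ⊢
    exact ⟨hS Q hQ.1, hQ.2⟩
  · obtain ⟨hQ, hTQ, hQP⟩ := Finset.mem_filter.1 hQ
    obtain ⟨R, hR, rfl⟩ := hS' Q hQ hTQ
    exact ⟨R, Finset.mem_filter.2 ⟨hR, ι.le_iff_le.1 hTQ, ι.le_iff_le.1 hQP⟩, rfl⟩

theorem sum_moebius_mul_pow_eq_relCharPoly {ι : Type*} [Fintype ι] {b : ι → α} {m : ι → ℤ}
    (hP : P ∈ S) (hT : T ≤ P) (hb : ∀ i, b i ∈ S ∧ T ≤ b i ∧ b i ≤ P)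
    (hm : ∀ R ∈ S, T ≤ R → R ≤ P → ∑ i with R ≤ b i, m i = if R = P then 1 else 0) :
    ∑ i, C (m i) * X ^ (d (b i) - d T) = relCharPoly S d T P := by
  calc ∑ i, C (m i) * (X : ℤ[X]) ^ (d (b i) - d T)
      = ∑ i, ∑ R ∈ S with T ≤ R ∧ R ≤ P,
          if R ≤ b i then C (m i) * relCharPoly S d T R else 0 := by
        refine Finset.sum_congr rfl fun i _ => ?_
        obtain ⟨hS, hTi, hiP⟩ := hb i
        rw [← sum_relCharPoly hS hTi, Finset.mul_sum, ← Finset.sum_filter, Finset.filter_filter]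
        refine Finset.sum_congr (Finset.filter_congr fun R _ => ?_) fun _ _ => rfl
        exact ⟨fun h => ⟨⟨h.1, h.2.trans hiP⟩, h.2⟩, fun h => ⟨h.1.1, h.2⟩⟩
    _ = ∑ R ∈ S with T ≤ R ∧ R ≤ P, if R = P then relCharPoly S d T R else 0 := by
        rw [Finset.sum_comm]
        refine Finset.sum_congr rfl fun R hR => ?_
        obtain ⟨hRS, hTR, hRP⟩ := Finset.mem_filter.1 hR
        rw [← Finset.sum_filter, ← Finset.sum_mul, ← map_sum, hm R hRS hTR hRP]
        split_ifs <;> simp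
    _ = relCharPoly S d T P := by
        rw [Finset.sum_ite_eq', if_pos (by simp [hP, hT])]

end RelCharPoly

/-! ### Modular lattices with a rank function -/

/-- A rank function on a modular lattice, such as the dimension of subspaces. -/
structure IsRankFunction {α : Type*} [Lattice α] (d : α → ℕ) : Prop where
  strictMono : StrictMono d
  sup_add_inf : ∀ a b, d (a ⊔ b) + d (a ⊓ b) = d a + d b

/-- A member `X` of a set `S` of elements of a lattice is modular if `S` is closed under joining
with `X`. For a set of subspaces that is closed under intersections, this is equivalent to
modularity of the flat `X` of the matroid. -/
structure IsModularElement {α : Type*} [Lattice α] (S : Finset α) (X : α) : Prop where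
  mem : X ∈ S
  sup_mem : ∀ Y ∈ S, Y ⊔ X ∈ S

/-- Modular elements `P₁` and `P₂` such that every `Y ∈ S` is determined by its two localizations
`Y ⊔ P₁` and `Y ⊔ P₂`: the lattice-theoretic form of a generalized parallel connection. -/
structure IsParallelConnection {α : Type*} [Lattice α] (S : Finset α) (P₁ P₂ : α) : Prop where
  left : IsModularElement S P₁
  right : IsModularElement S P₂
  inf_le : ∀ Y ∈ S, (Y ⊔ P₁) ⊓ (Y ⊔ P₂) ≤ Y

theorem IsModularElement.sup {α : Type*} [Lattice α] {S : Finset α} {P₁ P₂ : α}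
    (h₁ : IsModularElement S P₁) (h₂ : IsModularElement S P₂) : IsModularElement S (P₁ ⊔ P₂) :=
  ⟨h₂.sup_mem _ h₁.mem, fun Y hY => sup_assoc Y P₁ P₂ ▸ h₂.sup_mem _ (h₁.sup_mem Y hY)⟩

section ModularFactorization

open scoped Classical

variable {α : Type*} [Lattice α] {S : Finset α} {d : α → ℕ} {T X Y C P₁ P₂ : α}

theorem IsRankFunction.exponent_add [IsModularLattice α] (hd : IsRankFunction d) (hTX : T ≤ X)
    (hTY : T ≤ Y) (hXC : X ≤ C) (hCY : C ≤ Y ⊔ X) :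
    d (Y ⊓ C) - d T = (d (Y ⊓ X) - d T) + (d C - d X) := by
  have hrank := hd.sup_add_inf (Y ⊓ C) X
  have hsup : Y ⊓ C ⊔ X = C := by
    rw [inf_comm, inf_sup_assoc_of_le Y hXC, inf_eq_left.2 hCY]
  have hinf : Y ⊓ C ⊓ X = Y ⊓ X := by rw [inf_assoc, inf_eq_right.2 hXC]
  rw [hsup, hinf] at hrank
  have := hd.strictMono.monotone hXC
  have := hd.strictMono.monotone (le_inf hTY hTX)
  omega

theorem IsParallelConnection.inf_eq (h : IsParallelConnection S P₁ P₂) (hY : Y ∈ S) :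
    (Y ⊔ P₁) ⊓ (Y ⊔ P₂) = Y :=
  le_antisymm (h.inf_le Y hY) (le_inf le_sup_left le_sup_left)

theorem IsParallelConnection.exponent_add (h : IsParallelConnection S P₁ P₂)
    (hd : IsRankFunction d) (hY : Y ∈ S) (hTY : P₁ ⊓ P₂ ≤ Y) :
    d (Y ⊓ (P₁ ⊔ P₂)) - d (P₁ ⊓ P₂) =
      (d ((Y ⊔ P₁) ⊓ (P₁ ⊔ P₂)) - d P₁) + (d ((Y ⊔ P₂) ⊓ (P₁ ⊔ P₂)) - d P₂) := by
  have hrank := hd.sup_add_inf Y (P₁ ⊔ P₂)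
  have hrank₁ := hd.sup_add_inf (Y ⊔ P₁) (P₁ ⊔ P₂)
  have hrank₂ := hd.sup_add_inf (Y ⊔ P₂) (P₁ ⊔ P₂)
  have hrank₁₂ := hd.sup_add_inf (Y ⊔ P₁) (Y ⊔ P₂)
  have hrankP := hd.sup_add_inf P₁ P₂
  rw [sup_assoc, sup_eq_right.2 (le_sup_left : P₁ ≤ P₁ ⊔ P₂)] at hrank₁
  rw [sup_assoc, sup_eq_right.2 (le_sup_right : P₂ ≤ P₁ ⊔ P₂)] at hrank₂
  rw [← sup_sup_distrib_left, h.inf_eq hY] at hrank₁₂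
  have := hd.strictMono.monotone (le_inf hTY (inf_le_left.trans (le_sup_left : P₁ ≤ P₁ ⊔ P₂)))
  have := hd.strictMono.monotone
    (le_inf (le_sup_right : P₁ ≤ Y ⊔ P₁) (le_sup_left : P₁ ≤ P₁ ⊔ P₂))
  have := hd.strictMono.monotone
    (le_inf (le_sup_right : P₂ ≤ Y ⊔ P₂) (le_sup_right : P₂ ≤ P₁ ⊔ P₂))
  omega

theorem IsParallelConnection.sum_mul_sum_eq [IsModularLattice α] {R : Type*}
    [NonUnitalNonAssocSemiring R] (h : IsParallelConnection S P₁ P₂) (hS : InfClosed (S : Set α))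
    (f g : α → R) (hY : Y ∈ S) :
    (∑ Q ∈ S with (P₁ ≤ Q ∧ Q ≤ Y ⊔ P₁) ∧ Q ⊔ (P₁ ⊔ P₂) = C, f Q) *
        ∑ Q ∈ S with (P₂ ≤ Q ∧ Q ≤ Y ⊔ P₂) ∧ Q ⊔ (P₁ ⊔ P₂) = C, g Q =
      ∑ Q ∈ S with (P₁ ⊓ P₂ ≤ Q ∧ Q ≤ Y) ∧ Q ⊔ (P₁ ⊔ P₂) = C, f (Q ⊔ P₁) * g (Q ⊔ P₂) := by
  have sup_inf_eq {A B : α} (hA : P₁ ≤ A) (hB : P₂ ≤ B) (hAC : A ⊔ (P₁ ⊔ P₂) = C)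
      (hBC : B ⊔ (P₁ ⊔ P₂) = C) : A ⊓ B ⊔ P₁ = A ∧ A ⊓ B ⊔ P₂ = B := by
    rw [← sup_assoc, sup_eq_left.2 hA] at hAC
    rw [sup_left_comm, sup_eq_left.2 hB] at hBC
    rw [inf_sup_assoc_of_le B hA, inf_comm A B, inf_sup_assoc_of_le A hB, inf_eq_left, inf_eq_left,
      sup_comm B, hBC, hAC]
    exact ⟨hAC ▸ le_sup_left, hBC ▸ le_sup_right⟩
  rw [Finset.sum_mul_sum, ← Finset.sum_product']
  symm
  refine Finset.sum_bij' (fun Q _ => (Q ⊔ P₁, Q ⊔ P₂)) (fun Q _ => Q.1 ⊓ Q.2) ?_ ?_ ?_ ?_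
    fun _ _ => rfl
  · intro Q hQ
    simp only [Finset.mem_filter, Finset.mem_product] at hQ ⊢
    obtain ⟨hQS, ⟨-, hQY⟩, rfl⟩ := hQ
    refine ⟨⟨h.left.sup_mem _ hQS, ⟨le_sup_right, sup_le_sup_right hQY _⟩, ?_⟩,
      h.right.sup_mem _ hQS, ⟨le_sup_right, sup_le_sup_right hQY _⟩, ?_⟩
    · rw [sup_assoc, sup_left_idem]
    · rw [sup_assoc, sup_eq_right.2 (le_sup_right : P₂ ≤ P₁ ⊔ P₂)]
  · rintro ⟨A, B⟩ hAB
    simp only [Finset.mem_filter, Finset.mem_product] at hAB ⊢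
    obtain ⟨⟨hAS, ⟨hPA, hAY⟩, hAC⟩, hBS, ⟨hPB, hBY⟩, hBC⟩ := hAB
    refine ⟨hS hAS hBS, ⟨inf_le_inf hPA hPB, (inf_le_inf hAY hBY).trans (h.inf_le Y hY)⟩, ?_⟩
    rw [← sup_assoc, (sup_inf_eq hPA hPB hAC hBC).1, ← hAC, ← sup_assoc, sup_eq_left.2 hPA]
  · intro Q hQ
    exact h.inf_eq (Finset.mem_filter.1 hQ).1
  · rintro ⟨A, B⟩ hAB
    simp only [Finset.mem_filter, Finset.mem_product] at hAB
    obtain ⟨⟨-, ⟨hPA, -⟩, hAC⟩, -, ⟨hPB, -⟩, hBC⟩ := hAB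
    exact Prod.ext (sup_inf_eq hPA hPB hAC hBC).1 (sup_inf_eq hPA hPB hAC hBC).2

variable [IsModularLattice α] [WellFoundedLT α]

theorem sum_relCharPoly_fiberwise_sup (hd : IsRankFunction d) (hS : InfClosed (S : Set α))
    (hX : IsModularElement S X) (hTX : T ≤ X) (hY : Y ∈ S) (hTY : T ≤ Y) (hC : C ∈ S)
    (hXC : X ≤ C) (hCY : C ≤ Y ⊔ X) :
    ∑ Q ∈ S with (T ≤ Q ∧ Q ≤ Y) ∧ Q ⊔ X = C, relCharPoly S d T Q
      = Polynomial.X ^ (d (Y ⊓ X) - d T) * relCharPoly S d X C := by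
  refine eq_mul_relCharPoly_of_sum_eq (B := Y ⊔ X)
    (f := fun C => ∑ Q ∈ S with (T ≤ Q ∧ Q ≤ Y) ∧ Q ⊔ X = C, relCharPoly S d T Q)
    (fun C hC hXC hCY => ?_) C hC hXC hCY
  have hmap : ∀ Q ∈ S.filter (fun Q => T ≤ Q ∧ Q ≤ Y ⊓ C),
      Q ⊔ X ∈ S.filter fun Q => X ≤ Q ∧ Q ≤ C := by
    intro Q hQ
    rw [Finset.mem_filter] at hQ ⊢
    exact ⟨hX.sup_mem _ hQ.1, le_sup_right, sup_le (hQ.2.2.trans inf_le_right) hXC⟩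
  rw [← pow_add, ← hd.exponent_add hTX hTY hXC hCY,
    ← sum_relCharPoly (hS hY hC) (le_inf hTY (hTX.trans hXC)),
    ← Finset.sum_fiberwise_of_maps_to hmap]
  refine Finset.sum_congr rfl fun D hD => Finset.sum_congr ?_ fun _ _ => rfl
  have hDC := (Finset.mem_filter.1 hD).2.2
  ext Q
  simp only [Finset.mem_filter, le_inf_iff]
  constructor
  · rintro ⟨hQ, ⟨hTQ, hQY⟩, rfl⟩
    exact ⟨⟨hQ, hTQ, hQY, le_sup_left.trans hDC⟩, rfl⟩
  · rintro ⟨⟨hQ, hTQ, hQY, -⟩, hQD⟩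
    exact ⟨hQ, ⟨hTQ, hQY⟩, hQD⟩

theorem relCharPoly_eq_relCharPoly_sup (hd : IsRankFunction d) (hS : InfClosed (S : Set α))
    (hX : IsModularElement S X) (hY : Y ∈ S) (hT : Y ⊓ X = T) :
    relCharPoly S d T Y = relCharPoly S d X (Y ⊔ X) := by
  subst hT
  have hfiber := sum_relCharPoly_fiberwise_sup hd hS hX inf_le_right hY inf_le_left
    (hX.sup_mem Y hY) le_sup_right le_rfl
  rw [Nat.sub_self, pow_zero, one_mul] at hfiber
  rw [← hfiber]
  symm
  refine Finset.sum_eq_single_of_mem Y (by simp [hY]) fun Q hQ hne => absurd ?_ hne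
  obtain ⟨-, ⟨hTQ, hQY⟩, hsup⟩ := Finset.mem_filter.1 hQ
  exact eq_of_le_of_inf_le_of_sup_le hQY (le_inf hTQ inf_le_right) hsup.ge

/-- In the sum over all `Q` between `T` and `Y` with `Q ⊔ X = Y`, the terms with `Q ≠ Y` satisfy
`Q ⊓ X = T` and are equal to `relCharPoly S d X Y`. -/
theorem relCharPoly_dvd_of_rank_eq_add_one (hd : IsRankFunction d) (hS : InfClosed (S : Set α))
    (hX : IsModularElement S X) (hTX : T ≤ X) (hrank : d X = d T + 1) (hY : Y ∈ S) (hXY : X ≤ Y) :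
    relCharPoly S d X Y ∣ relCharPoly S d T Y := by
  have hfiber := sum_relCharPoly_fiberwise_sup hd hS hX hTX hY (hTX.trans hXY) hY hXY le_sup_left
  have hmem : Y ∈ S.filter fun Q => (T ≤ Q ∧ Q ≤ Y) ∧ Q ⊔ X = Y := by
    simp [hY, hTX.trans hXY, hXY]
  rw [← Finset.add_sum_erase _ _ hmem] at hfiber
  refine (dvd_add_left (Finset.dvd_sum fun Q hQ => ?_)).1 (hfiber ▸ dvd_mul_left _ _)
  rw [Finset.mem_erase, Finset.mem_filter] at hQ
  obtain ⟨hne, hQS, ⟨hTQ, hQY⟩, hsup⟩ := hQ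
  have hinf : Q ⊓ X = T := by
    have hsum := hd.sup_add_inf Q X
    have hlt := hd.strictMono (hQY.lt_of_ne hne)
    rw [hsup] at hsum
    refine ((le_inf hTQ hTX).eq_of_not_lt fun h => ?_).symm
    have := hd.strictMono h
    omega
  rw [relCharPoly_eq_relCharPoly_sup hd hS hX hQS hinf, hsup]

theorem IsParallelConnection.relCharPoly_mul_relCharPoly (h : IsParallelConnection S P₁ P₂)
    (hd : IsRankFunction d) (hS : InfClosed (S : Set α)) (hY : Y ∈ S) (hTY : P₁ ⊓ P₂ ≤ Y) :
    relCharPoly S d (P₁ ⊓ P₂) Y * relCharPoly S d (P₁ ⊔ P₂) (Y ⊔ (P₁ ⊔ P₂))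
      = relCharPoly S d P₁ (Y ⊔ P₁) * relCharPoly S d P₂ (Y ⊔ P₂) := by
  induction Y using WellFoundedLT.induction with
  | ind Y ih =>
  have hN := h.left.sup h.right
  have hYC := hN.sup_mem _ hY
  have hle₁ : P₁ ≤ P₁ ⊔ P₂ := le_sup_left
  have hle₂ : P₂ ≤ P₁ ⊔ P₂ := le_sup_right
  have hsum : ∑ Q ∈ S with (P₁ ⊓ P₂ ≤ Q ∧ Q ≤ Y) ∧ Q ⊔ (P₁ ⊔ P₂) = Y ⊔ (P₁ ⊔ P₂),
      relCharPoly S d (P₁ ⊓ P₂) Q * relCharPoly S d (P₁ ⊔ P₂) (Y ⊔ (P₁ ⊔ P₂)) =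
      ∑ Q ∈ S with (P₁ ⊓ P₂ ≤ Q ∧ Q ≤ Y) ∧ Q ⊔ (P₁ ⊔ P₂) = Y ⊔ (P₁ ⊔ P₂),
        relCharPoly S d P₁ (Q ⊔ P₁) * relCharPoly S d P₂ (Q ⊔ P₂) := by
    rw [← h.sum_mul_sum_eq hS _ _ hY, ← Finset.sum_mul,
      sum_relCharPoly_fiberwise_sup hd hS hN (inf_le_left.trans hle₁) hY hTY hYC le_sup_right
        le_rfl,
      sum_relCharPoly_fiberwise_sup hd hS hN hle₁ (h.left.sup_mem Y hY) le_sup_right hYC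
        le_sup_right (sup_le_sup_right le_sup_left _),
      sum_relCharPoly_fiberwise_sup hd hS hN hle₂ (h.right.sup_mem Y hY) le_sup_right hYC
        le_sup_right (sup_le_sup_right le_sup_left _),
      h.exponent_add hd hY hTY, pow_add]
    ring
  rw [← sub_eq_zero, ← Finset.sum_sub_distrib,
    Finset.sum_eq_single_of_mem Y (by simp [hY, hTY]), sub_eq_zero] at hsum
  · exact hsum
  · intro Q hQ hne
    obtain ⟨hQS, ⟨hTQ, hQY⟩, hQC⟩ := Finset.mem_filter.1 hQ
    rw [sub_eq_zero, ← hQC, ih Q (hQY.lt_of_ne hne) hQS hTQ]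

end ModularFactorization

/-! ### Divisional chains -/

/-- A step of a divisional flag of the part of `S` above `T`. -/
structure DivisionalStep {α : Type*} [PartialOrder α] [WellFoundedLT α] (S : Finset α) (d : α → ℕ)
    (T P Q : α) : Prop where
  le : Q ≤ P
  base_le : T ≤ Q
  mem : Q ∈ S
  rank_eq : d P = d Q + 1
  dvd : relCharPoly S d T Q ∣ relCharPoly S d T P

/-- `DivisionalChain S d T P Q`: some segment of a divisional flag of the part of `S` above `T`
descends from `P` to `Q`. -/
abbrev DivisionalChain {α : Type*} [PartialOrder α] [WellFoundedLT α] (S : Finset α) (d : α → ℕ)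
    (T : α) : α → α → Prop :=
  Relation.ReflTransGen (DivisionalStep S d T)

namespace DivisionalChain

variable {α β : Type*} [PartialOrder α] [WellFoundedLT α] [PartialOrder β] [WellFoundedLT β]
  {S : Finset α} {d : α → ℕ} {T P Q : α} {S' : Finset β} {d' : β → ℕ} {T' : β}

theorem mem (h : DivisionalChain S d T P Q) (hP : P ∈ S) : Q ∈ S := by
  induction h with
  | refl => exact hP
  | tail _ hstep _ => exact hstep.mem

theorem map (f : α → β) (h : DivisionalChain S d T P Q) (hP : P ∈ S)
    (hf : ∀ A ∈ S, ∀ B, Q ≤ B → DivisionalStep S d T A B → DivisionalStep S' d' T' (f A) (f B)) :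
    DivisionalChain S' d' T' (f P) (f Q) := by
  induction h with
  | refl => exact .refl
  | tail hchain hstep ih =>
    exact (ih fun A hA B hB hAB => hf A hA B (hstep.le.trans hB) hAB).tail
      (hf _ (DivisionalChain.mem hchain hP) _ le_rfl hstep)

theorem map_orderEmbedding {c : ℕ} (ι : α ↪o β) (hd : ∀ P, d' (ι P) = d P + c)
    (hS : ∀ P ∈ S, ι P ∈ S') (hS' : ∀ Q ∈ S', ι T ≤ Q → ∃ P ∈ S, ι P = Q)
    (h : DivisionalChain S d T P Q) (hP : P ∈ S) :
    DivisionalChain S' d' (ι T) (ι P) (ι Q) := by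
  refine map ι h hP fun A hA B _ hAB => ⟨ι.monotone hAB.le, ι.monotone hAB.base_le, hS B hAB.mem,
    by rw [hd, hd, hAB.rank_eq, add_right_comm], ?_⟩
  rw [relCharPoly_map ι hd hS hS' hA (hAB.base_le.trans hAB.le),
    relCharPoly_map ι hd hS hS' hAB.mem hAB.base_le]
  exact hAB.dvd

end DivisionalChain

/-- `a` and `b` are complements of each other in the interval `[T, ⊤]`. -/
structure IsComplOver {α : Type*} [Lattice α] [OrderTop α] (T a b : α) : Prop where
  sup_eq : a ⊔ b = ⊤
  inf_eq : a ⊓ b = T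

namespace IsComplOver

variable {α : Type*} [Lattice α] [OrderTop α] {T X Y C C' e w : α}

theorem symm (h : IsComplOver T e X) : IsComplOver T X e :=
  ⟨sup_comm e X ▸ h.sup_eq, inf_comm e X ▸ h.inf_eq⟩

theorem le_left (h : IsComplOver T e X) : T ≤ e := h.inf_eq ▸ inf_le_left

theorem le_right (h : IsComplOver T e X) : T ≤ X := h.inf_eq ▸ inf_le_right

theorem inf_inf_eq (h : IsComplOver T e X) (hXY : X ≤ Y) : e ⊓ Y ⊓ X = T := by
  rw [inf_assoc, inf_eq_right.2 hXY, h.inf_eq]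

theorem of_rank {d : α → ℕ} (hd : IsRankFunction d) (hinf : e ⊓ X = T)
    (hrank : d e + d X = d ⊤ + d T) : IsComplOver T e X where
  sup_eq := by
    have hsum := hd.sup_add_inf e X
    rw [hinf] at hsum
    refine eq_top_iff.2 (le_of_eq (le_top.eq_of_not_lt fun hlt => ?_).symm)
    have := hd.strictMono hlt
    omega
  inf_eq := hinf

variable [IsModularLattice α]

theorem inf_sup_eq (h : IsComplOver T e X) (hXY : X ≤ Y) : e ⊓ Y ⊔ X = Y := by
  rw [inf_comm, inf_sup_assoc_of_le e hXY, h.sup_eq, inf_top_eq]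

theorem rank_inf_add {d : α → ℕ} (h : IsComplOver T e X) (hd : IsRankFunction d) (hXY : X ≤ Y) :
    d (e ⊓ Y) + d X = d Y + d T := by
  rw [← hd.sup_add_inf, h.inf_sup_eq hXY, h.inf_inf_eq hXY]

theorem inf_left (h : IsComplOver T e X) (hw : IsComplOver X w C) : IsComplOver T (e ⊓ w) C where
  sup_eq := by
    rw [← sup_eq_right.2 hw.le_right, ← sup_assoc, h.inf_sup_eq hw.le_left, hw.sup_eq]
  inf_eq := by rw [inf_assoc, hw.inf_eq, h.inf_eq]

theorem congr_of_inf_eq (h : IsComplOver T w C) (hwe : w ≤ e) (htop : e ⊔ C' = ⊤)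
    (hC : e ⊓ C = e ⊓ C') : IsComplOver T w C' where
  sup_eq := by
    have hle : e ≤ w ⊔ C' :=
      calc e = w ⊔ e ⊓ C := by rw [inf_comm, ← sup_inf_assoc_of_le C hwe, h.sup_eq, top_inf_eq]
        _ ≤ w ⊔ C' := sup_le_sup_left (hC.le.trans inf_le_right) w
    rw [← top_le_iff, ← htop]
    exact sup_le hle le_sup_right
  inf_eq := by rw [← inf_eq_left.2 hwe, inf_assoc, ← hC, ← inf_assoc, inf_eq_left.2 hwe, h.inf_eq]

end IsComplOver

/-- The element `C` has a complement `w ∈ S` in `[T, ⊤]` through which a divisional flag passes. -/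
def HasComplementaryFlag {α : Type*} [Lattice α] [OrderTop α] [WellFoundedLT α] (S : Finset α)
    (d : α → ℕ) (T C : α) : Prop :=
  ∃ w ∈ S, IsComplOver T w C ∧ DivisionalChain S d T ⊤ w ∧ DivisionalChain S d T w T

section ModularElement

variable {α : Type*} [Lattice α] [OrderTop α] [IsModularLattice α] [WellFoundedLT α]
  {S : Finset α} {d : α → ℕ} {T X Y C e : α}

theorem IsModularElement.relCharPoly_inf (hX : IsModularElement S X) (hd : IsRankFunction d)
    (hS : InfClosed (S : Set α)) (heS : e ∈ S) (he : IsComplOver T e X) (hY : Y ∈ S)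
    (hXY : X ≤ Y) : relCharPoly S d T (e ⊓ Y) = relCharPoly S d X Y := by
  rw [relCharPoly_eq_relCharPoly_sup hd hS hX (hS heS hY) (he.inf_inf_eq hXY), he.inf_sup_eq hXY]

theorem IsModularElement.divisionalChain_inf {P Q : α} (hX : IsModularElement S X)
    (hd : IsRankFunction d) (hS : InfClosed (S : Set α)) (heS : e ∈ S) (he : IsComplOver T e X)
    (hP : P ∈ S) (hXQ : X ≤ Q) (hPQ : DivisionalChain S d X P Q) :
    DivisionalChain S d T (e ⊓ P) (e ⊓ Q) := by
  refine hPQ.map (e ⊓ ·) hP fun A hA B hQB hAB => ?_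
  have hXB := hXQ.trans hQB
  have hXA := hXB.trans hAB.le
  refine ⟨inf_le_inf_left _ hAB.le, le_inf he.le_left (he.le_right.trans hXB),
    hS heS hAB.mem, ?_, ?_⟩
  · have := he.rank_inf_add hd hXA
    have := he.rank_inf_add hd hXB
    have := hAB.rank_eq
    omega
  · rw [hX.relCharPoly_inf hd hS heS he hA hXA, hX.relCharPoly_inf hd hS heS he hAB.mem hXB]
    exact hAB.dvd

theorem IsModularElement.divisionalStep_inf (hX : IsModularElement S X) (hd : IsRankFunction d)
    (hS : InfClosed (S : Set α)) (heS : e ∈ S) (he : IsComplOver T e X) (hrank : d X = d T + 1)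
    (hY : Y ∈ S) (hXY : X ≤ Y) : DivisionalStep S d T Y (e ⊓ Y) where
  le := inf_le_right
  base_le := le_inf he.le_left (he.le_right.trans hXY)
  mem := hS heS hY
  rank_eq := by
    have := he.rank_inf_add hd hXY
    omega
  dvd := by
    rw [hX.relCharPoly_inf hd hS heS he hY hXY]
    exact relCharPoly_dvd_of_rank_eq_add_one hd hS hX he.le_right hrank hY hXY

theorem HasComplementaryFlag.of_isModularElement_of_inf_eq (h : HasComplementaryFlag S d X C)
    (hX : IsModularElement S X) (hd : IsRankFunction d) (hS : InfClosed (S : Set α))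
    (htop : ⊤ ∈ S) (heS : e ∈ S) (he : IsComplOver T e X) (hchain : DivisionalChain S d T ⊤ e)
    (hsup : e ⊔ C' = ⊤) (hinf : e ⊓ C = e ⊓ C') : HasComplementaryFlag S d T C' := by
  obtain ⟨w, hw, hwC, htopw, hwX⟩ := h
  have hupper := hX.divisionalChain_inf hd hS heS he htop hwC.le_left htopw
  have hlower := hX.divisionalChain_inf hd hS heS he hw le_rfl hwX
  rw [inf_top_eq] at hupper
  rw [he.inf_eq] at hlower
  exact ⟨e ⊓ w, hS heS hw, (he.inf_left hwC).congr_of_inf_eq inf_le_left hsup hinf,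
    hchain.trans hupper, hlower⟩

theorem HasComplementaryFlag.of_isModularElement (h : HasComplementaryFlag S d X C)
    (hX : IsModularElement S X) (hd : IsRankFunction d) (hS : InfClosed (S : Set α))
    (htop : ⊤ ∈ S) (heS : e ∈ S) (he : IsComplOver T e X) (hchain : DivisionalChain S d T ⊤ e) :
    HasComplementaryFlag S d T C := by
  have hXC : X ≤ C := h.elim fun _ hw => hw.2.1.le_right
  exact h.of_isModularElement_of_inf_eq hX hd hS htop heS he hchain
    (top_le_iff.1 (he.sup_eq.ge.trans (sup_le_sup_left hXC e))) rfl

/-- By the product formula, the two relative characteristic polynomials differ along the chain by a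
constant nonzero factor. -/
theorem IsParallelConnection.divisionalChain {P₁ P₂ w : α} (h : IsParallelConnection S P₁ P₂)
    (hd : IsRankFunction d) (hS : InfClosed (S : Set α)) (htop : ⊤ ∈ S) (hw : P₂ ≤ w)
    (hsup : w ⊔ P₁ = ⊤) (hchain : DivisionalChain S d P₂ ⊤ w) :
    DivisionalChain S d (P₁ ⊓ P₂) ⊤ w := by
  have hprod : ∀ Y ∈ S, w ≤ Y → relCharPoly S d (P₁ ⊓ P₂) Y * relCharPoly S d (P₁ ⊔ P₂) ⊤ =
      relCharPoly S d P₁ ⊤ * relCharPoly S d P₂ Y := by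
    intro Y hY hwY
    have hY₁ : Y ⊔ P₁ = ⊤ := top_le_iff.1 (hsup.ge.trans (sup_le_sup_right hwY _))
    have := h.relCharPoly_mul_relCharPoly hd hS hY (inf_le_right.trans (hw.trans hwY))
    rwa [← sup_assoc, hY₁, top_sup_eq, sup_eq_left.2 (hw.trans hwY)] at this
  refine hchain.map id htop fun A hA B hwB hAB => ⟨hAB.le, inf_le_right.trans hAB.base_le, hAB.mem,
    hAB.rank_eq, ?_⟩
  have hdvd := mul_dvd_mul_left (relCharPoly S d P₁ ⊤) hAB.dvd
  rw [← hprod A hA (hwB.trans hAB.le), ← hprod B hAB.mem hwB] at hdvd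
  exact (mul_dvd_mul_iff_right (relCharPoly_ne_zero hd.strictMono _ _)).1 hdvd

end ModularElement

/-! ### Intersections of hyperplanes -/

section Intersections

variable {α : Type*} [CompleteLattice α] {𝓗 𝓗' : Set α} {h : 𝓗.Finite} {P : α}

/-- The lattice of intersections of a finite set of hyperplanes; the empty intersection is `⊤`. -/
noncomputable def intersections (h : 𝓗.Finite) : Finset α :=
  (h.finite_subsets.image sInf).toFinset

/-- The localization of a set of hyperplanes at `P`: its members that contain `P`. -/
def above (𝓗 : Set α) (P : α) : Set α := {H ∈ 𝓗 | P ≤ H}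

theorem above_subset (𝓗 : Set α) (P : α) : above 𝓗 P ⊆ 𝓗 := Set.sep_subset _ _

theorem above_anti (𝓗 : Set α) : Antitone (above 𝓗) := fun _ _ hPQ _ hH => ⟨hH.1, hPQ.trans hH.2⟩

theorem le_sInf_above (𝓗 : Set α) (P : α) : P ≤ sInf (above 𝓗 P) := le_sInf fun _ hH => hH.2

theorem mem_intersections : P ∈ intersections h ↔ ∃ B ⊆ 𝓗, sInf B = P := by
  simp [intersections]

theorem sInf_mem_intersections {B : Set α} (hB : B ⊆ 𝓗) : sInf B ∈ intersections h :=
  mem_intersections.2 ⟨B, hB, rfl⟩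

theorem mem_intersections_iff_sInf_above_le :
    P ∈ intersections h ↔ sInf (above 𝓗 P) ≤ P := by
  rw [mem_intersections]
  constructor
  · rintro ⟨B, hB, rfl⟩
    exact sInf_le_sInf fun H hH => ⟨hB hH, sInf_le hH⟩
  · exact fun hP => ⟨above 𝓗 P, above_subset 𝓗 P, hP.antisymm (le_sInf_above 𝓗 P)⟩

theorem sInf_above_eq (hP : P ∈ intersections h) : sInf (above 𝓗 P) = P :=
  (mem_intersections_iff_sInf_above_le.1 hP).antisymm (le_sInf_above 𝓗 P)

theorem mem_intersections_of_mem (hP : P ∈ 𝓗) : P ∈ intersections h :=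
  mem_intersections_iff_sInf_above_le.2 (sInf_le ⟨hP, le_rfl⟩)

theorem top_mem_intersections : ⊤ ∈ intersections h :=
  mem_intersections_iff_sInf_above_le.2 le_top

theorem sInf_le_of_mem_intersections (hP : P ∈ intersections h) : sInf 𝓗 ≤ P :=
  sInf_above_eq hP ▸ sInf_le_sInf (above_subset 𝓗 P)

theorem infClosed_intersections (h : 𝓗.Finite) : InfClosed (intersections h : Set α) :=
  fun _ hP _ hQ => mem_intersections_iff_sInf_above_le.2 <| le_inf
    ((sInf_le_sInf (above_anti 𝓗 inf_le_left)).trans (mem_intersections_iff_sInf_above_le.1 hP))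
    ((sInf_le_sInf (above_anti 𝓗 inf_le_right)).trans (mem_intersections_iff_sInf_above_le.1 hQ))

section Map

variable {β : Type*} [CompleteLattice β] {𝓖 : Set β} {h𝓖 : 𝓖.Finite} (ι : α ↪o β)

theorem map_mem_intersections (hι : ∀ B : Set α, ι (sInf B) = sInf (ι '' B))
    (h𝓗 : above 𝓖 (ι (sInf 𝓗)) = ι '' 𝓗) (hP : P ∈ intersections h) :
    ι P ∈ intersections h𝓖 := by
  obtain ⟨B, hB, rfl⟩ := mem_intersections.1 hP
  rw [hι]
  exact sInf_mem_intersections ((Set.image_mono hB).trans (h𝓗 ▸ above_subset 𝓖 _))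

theorem exists_map_eq_of_mem_intersections (hι : ∀ B : Set α, ι (sInf B) = sInf (ι '' B))
    (h𝓗 : above 𝓖 (ι (sInf 𝓗)) = ι '' 𝓗) {Q : β} (hQ : Q ∈ intersections h𝓖)
    (hle : ι (sInf 𝓗) ≤ Q) : ∃ P ∈ intersections h, ι P = Q := by
  obtain ⟨B, hB, hBQ⟩ := Set.subset_image_iff.1 (h𝓗 ▸ above_anti 𝓖 hle)
  exact ⟨sInf B, sInf_mem_intersections hB, by rw [hι, hBQ, sInf_above_eq hQ]⟩

variable [WellFoundedLT α] [WellFoundedLT β] {d : α → ℕ} {d' : β → ℕ} {c : ℕ}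

theorem DivisionalChain.map_intersections (hd : ∀ P, d' (ι P) = d P + c)
    (hι : ∀ B : Set α, ι (sInf B) = sInf (ι '' B)) (h𝓗 : above 𝓖 (ι (sInf 𝓗)) = ι '' 𝓗) {Q : α}
    (hPQ : DivisionalChain (intersections h) d (sInf 𝓗) P Q) (hP : P ∈ intersections h) :
    DivisionalChain (intersections h𝓖) d' (ι (sInf 𝓗)) (ι P) (ι Q) :=
  hPQ.map_orderEmbedding ι hd (fun _ => map_mem_intersections ι hι h𝓗)
    (fun _ => exists_map_eq_of_mem_intersections ι hι h𝓗) hP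

theorem HasComplementaryFlag.map_intersections (hrank : IsRankFunction d)
    (hrank' : IsRankFunction d') (hd : ∀ P, d' (ι P) = d P + c)
    (hι : ∀ B : Set α, ι (sInf B) = sInf (ι '' B)) (h𝓗 : above 𝓖 (ι (sInf 𝓗)) = ι '' 𝓗) {C : α}
    (hC : HasComplementaryFlag (intersections h) d (sInf 𝓗) C) :
    HasComplementaryFlag (intersections h𝓖) d' (ι (sInf 𝓗)) (ι C) := by
  obtain ⟨w, hw, hwC, hupper, hlower⟩ := hC
  have htop : ι ⊤ = ⊤ := by simpa using hι ∅
  have hinf : ι w ⊓ ι C = ι (sInf 𝓗) := by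
    have := hι {w, C}
    rwa [Set.image_pair, sInf_pair, sInf_pair, hwC.inf_eq, eq_comm] at this
  refine ⟨ι w, map_mem_intersections ι hι h𝓗 hw, .of_rank hrank' hinf ?_,
    htop ▸ hupper.map_intersections ι hd hι h𝓗 top_mem_intersections,
    hlower.map_intersections ι hd hι h𝓗 hw⟩
  have := hrank.sup_add_inf w C
  rw [hwC.sup_eq, hwC.inf_eq] at this
  rw [← htop, hd, hd, hd, hd]
  omega

end Map

/-- The members of `𝓗'` are the hyperplanes of `𝓗` that contain a modular flat of corank at most
one. For hyperplanes of a vector space, the last field says that the intersection of any two other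
hyperplanes lies on a third one from `𝓗'`, which is the usual criterion for supersolvability. -/
structure IsModularCoatomIn (d : α → ℕ) (𝓗' 𝓗 : Set α) : Prop where
  subset : 𝓗' ⊆ 𝓗
  rank_add_one : ∀ H ∈ 𝓗, d H + 1 = d ⊤
  not_le : ∀ e ∈ 𝓗, e ∉ 𝓗' → ¬ sInf 𝓗' ≤ e
  exists_line : ∀ e ∈ 𝓗, e ∉ 𝓗' → ∀ f ∈ 𝓗, f ∉ 𝓗' → e ≠ f → ∃ g ∈ 𝓗', e ⊓ f ≤ g ∧ e ⊓ g ≤ f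

theorem IsRankFunction.isCoatom_of_add_one_eq {d : α → ℕ} (hd : IsRankFunction d)
    (hP : d P + 1 = d ⊤) : IsCoatom P := by
  refine ⟨by rintro rfl; omega, fun Q hPQ => ?_⟩
  by_contra hQ
  have := hd.strictMono hPQ
  have := hd.strictMono (lt_top_iff_ne_top.2 hQ)
  omega

namespace IsModularCoatomIn

variable {d : α → ℕ} {e : α}

theorem isComplOver (hm : IsModularCoatomIn d 𝓗' 𝓗) (hd : IsRankFunction d) (he : e ∈ 𝓗)
    (he' : e ∉ 𝓗') : IsComplOver (sInf 𝓗) e (sInf 𝓗') where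
  sup_eq := (hd.isCoatom_of_add_one_eq (hm.rank_add_one e he)).2 _
    (left_lt_sup.2 (hm.not_le e he he'))
  inf_eq := by
    refine le_antisymm (le_sInf fun H hH => ?_) (le_inf (sInf_le he) (sInf_le_sInf hm.subset))
    by_cases hH' : H ∈ 𝓗'
    · exact inf_le_right.trans (sInf_le hH')
    by_cases heH : e = H
    · exact heH ▸ inf_le_left
    obtain ⟨g, hg, -, hle⟩ := hm.exists_line e he he' H hH hH' heH
    exact (inf_le_inf_left e (sInf_le hg)).trans hle

theorem rank_eq (hm : IsModularCoatomIn d 𝓗' 𝓗) (hd : IsRankFunction d) (he : e ∈ 𝓗)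
    (he' : e ∉ 𝓗') : d (sInf 𝓗') = d (sInf 𝓗) + 1 := by
  have hsum := hd.sup_add_inf e (sInf 𝓗')
  rw [(hm.isComplOver hd he he').sup_eq, (hm.isComplOver hd he he').inf_eq] at hsum
  have := hm.rank_add_one e he
  omega

theorem isModularElement [IsModularLattice α] (hm : IsModularCoatomIn d 𝓗' 𝓗)
    (hd : IsRankFunction d) : IsModularElement (intersections h) (sInf 𝓗') := by
  refine ⟨sInf_mem_intersections hm.subset, fun F hF => ?_⟩
  by_cases hFX : sInf 𝓗' ≤ F
  · rwa [sup_eq_left.2 hFX]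
  have hFle := mem_intersections_iff_sInf_above_le.1 hF
  obtain ⟨e, ⟨he, hFe⟩, he'⟩ : ∃ e ∈ above 𝓗 F, e ∉ 𝓗' := by
    by_contra! hsub
    exact hFX ((sInf_le_sInf hsub).trans hFle)
  have hXZ : sInf 𝓗' ≤ sInf (above 𝓗' F) := sInf_le_sInf (above_subset 𝓗' F)
  have heZ : e ⊓ sInf (above 𝓗' F) ≤ F := by
    suffices e ⊓ sInf (above 𝓗' F) ≤ sInf (above 𝓗 F) from this.trans hFle
    refine le_sInf fun H ⟨hH, hFH⟩ => ?_
    by_cases hH' : H ∈ 𝓗'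
    · exact inf_le_right.trans (sInf_le ⟨hH', hFH⟩)
    by_cases heH : e = H
    · exact heH ▸ inf_le_left
    obtain ⟨g, hg, hefg, hegf⟩ := hm.exists_line e he he' H hH hH' heH
    have hFg : g ∈ above 𝓗' F := ⟨hg, (le_inf hFe hFH).trans hefg⟩
    exact (inf_le_inf_left e (sInf_le hFg)).trans hegf
  refine mem_intersections_iff_sInf_above_le.2 ?_
  calc sInf (above 𝓗 (F ⊔ sInf 𝓗'))
      ≤ sInf (above 𝓗' F) :=
        sInf_le_sInf fun _ hH => ⟨hm.subset hH.1, sup_le hH.2 (sInf_le hH.1)⟩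
    _ = e ⊓ sInf (above 𝓗' F) ⊔ sInf 𝓗' := ((hm.isComplOver hd he he').inf_sup_eq hXZ).symm
    _ ≤ F ⊔ sInf 𝓗' := sup_le_sup_right heZ _

variable [IsModularLattice α] [WellFoundedLT α]

theorem divisionalStep_inf {Y : α} (hm : IsModularCoatomIn d 𝓗' 𝓗) (hd : IsRankFunction d)
    (he : e ∈ 𝓗) (he' : e ∉ 𝓗') (hY : Y ∈ intersections h) (hXY : sInf 𝓗' ≤ Y) :
    DivisionalStep (intersections h) d (sInf 𝓗) Y (e ⊓ Y) :=
  (hm.isModularElement hd).divisionalStep_inf hd (infClosed_intersections h)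
    (mem_intersections_of_mem he) (hm.isComplOver hd he he') (hm.rank_eq hd he he') hY hXY

theorem divisionalChain_inf {P Q : α} (hm : IsModularCoatomIn d 𝓗' 𝓗) (hd : IsRankFunction d)
    (he : e ∈ 𝓗) (he' : e ∉ 𝓗') (hP : P ∈ intersections h) (hQ : sInf 𝓗' ≤ Q)
    (hPQ : DivisionalChain (intersections h) d (sInf 𝓗') P Q) :
    DivisionalChain (intersections h) d (sInf 𝓗) (e ⊓ P) (e ⊓ Q) :=
  (hm.isModularElement hd).divisionalChain_inf hd (infClosed_intersections h)
    (mem_intersections_of_mem he) (hm.isComplOver hd he he') hP hQ hPQ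

theorem divisionalChain_top_of_notMem (hm : IsModularCoatomIn d 𝓗' 𝓗) (hd : IsRankFunction d)
    (he : e ∈ 𝓗) (he' : e ∉ 𝓗') : DivisionalChain (intersections h) d (sInf 𝓗) ⊤ e := by
  simpa using Relation.ReflTransGen.single
    (hm.divisionalStep_inf hd he he' top_mem_intersections le_top)

theorem hasComplementaryFlag_of_inf_eq {C C' : α} (hm : IsModularCoatomIn d 𝓗' 𝓗)
    (hd : IsRankFunction d) (he : e ∈ 𝓗) (he' : e ∉ 𝓗')
    (hC : HasComplementaryFlag (intersections h) d (sInf 𝓗') C) (hsup : e ⊔ C' = ⊤)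
    (hinf : e ⊓ C = e ⊓ C') : HasComplementaryFlag (intersections h) d (sInf 𝓗) C' :=
  hC.of_isModularElement_of_inf_eq (hm.isModularElement hd) hd (infClosed_intersections h)
    top_mem_intersections (mem_intersections_of_mem he) (hm.isComplOver hd he he')
    (hm.divisionalChain_top_of_notMem hd he he') hsup hinf

theorem hasComplementaryFlag {C : α} (hm : IsModularCoatomIn d 𝓗' 𝓗) (hd : IsRankFunction d)
    (he : e ∈ 𝓗) (he' : e ∉ 𝓗')
    (hC : HasComplementaryFlag (intersections h) d (sInf 𝓗') C) :
    HasComplementaryFlag (intersections h) d (sInf 𝓗) C :=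
  hC.of_isModularElement (hm.isModularElement hd) hd (infClosed_intersections h)
    top_mem_intersections (mem_intersections_of_mem he) (hm.isComplOver hd he he')
    (hm.divisionalChain_top_of_notMem hd he he')

theorem divisionalChain_top {h' : 𝓗'.Finite} (hm : IsModularCoatomIn d 𝓗' 𝓗)
    (hd : IsRankFunction d) (hchain : DivisionalChain (intersections h') d (sInf 𝓗') ⊤ (sInf 𝓗')) :
    DivisionalChain (intersections h) d (sInf 𝓗) ⊤ (sInf 𝓗) := by
  by_cases hex : ∃ e ∈ 𝓗, e ∉ 𝓗'
  · obtain ⟨e, he, he'⟩ := hex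
    have habove : above 𝓗 (sInf 𝓗') = 𝓗' :=
      Set.Subset.antisymm (fun H ⟨hH, hle⟩ => by_contra fun hH' => hm.not_le H hH hH' hle)
        fun H hH => ⟨hm.subset hH, sInf_le hH⟩
    have hchain' : DivisionalChain (intersections h) d (sInf 𝓗') ⊤ (sInf 𝓗') :=
      hchain.map_intersections (RelEmbedding.refl _) (c := 0) (fun _ => rfl)
        (fun B => congrArg sInf (Set.image_id B).symm) (habove.trans (Set.image_id 𝓗').symm)
        top_mem_intersections
    have hstep := hm.divisionalStep_inf hd he he' (h := h) top_mem_intersections le_top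
    have hlower := hm.divisionalChain_inf hd he he' top_mem_intersections le_rfl hchain'
    rw [(hm.isComplOver hd he he').inf_eq] at hlower
    exact hlower.head hstep
  · push Not at hex
    obtain rfl : 𝓗' = 𝓗 := hm.subset.antisymm hex
    exact hchain

end IsModularCoatomIn

theorem divisionalChain_of_inf_le [IsModularLattice α] [WellFoundedLT α] {d : α → ℕ}
    (hd : IsRankFunction d) (hrank : ∀ H ∈ 𝓗, d H + 1 = d ⊤)
    (hline : ∀ e ∈ 𝓗, ∀ f ∈ 𝓗, ∀ g ∈ 𝓗, e ≠ f → e ⊓ f ≤ g) :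
    DivisionalChain (intersections h) d (sInf 𝓗) ⊤ (sInf 𝓗) := by
  obtain rfl | ⟨e₀, he₀⟩ := 𝓗.eq_empty_or_nonempty
  · rw [sInf_empty]
  have hcoatom := fun H hH => hd.isCoatom_of_add_one_eq (hrank H hH)
  have hm₀ : IsModularCoatomIn d ∅ {e₀} :=
    { subset := Set.empty_subset _
      rank_add_one := by simpa using hrank e₀ he₀
      not_le := by simpa using (hcoatom e₀ he₀).1
      exists_line := fun _ he _ _ hf _ hef => absurd (Set.subsingleton_singleton he hf) hef }
  have hm : IsModularCoatomIn d {e₀} 𝓗 :=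
    { subset := Set.singleton_subset_iff.2 he₀
      rank_add_one := hrank
      not_le := fun e he hne hle => by
        rw [sInf_singleton] at hle
        exact hne (((hcoatom e₀ he₀).le_iff.1 hle).resolve_left (hcoatom e he).1)
      exists_line := fun e he hee₀ f hf _ hef =>
        ⟨e₀, rfl, hline e he f hf e₀ he₀ hef, hline e he e₀ he₀ f hf hee₀⟩ }
  refine hm.divisionalChain_top hd (h' := Set.finite_singleton e₀)
    (hm₀.divisionalChain_top hd (h' := Set.finite_empty) ?_)
  rw [sInf_empty]

end Intersections

/-! ### Divisional flags of hyperplane arrangements -/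

theorem exists_fun_of_reflTransGen {α : Type*} {r : α → α → Prop} {a b : α}
    (h : Relation.ReflTransGen r a b) :
    ∃ (n : ℕ) (f : ℕ → α), f 0 = a ∧ f n = b ∧ ∀ i < n, r (f i) (f (i + 1)) := by
  induction h using Relation.ReflTransGen.head_induction_on with
  | refl => exact ⟨0, fun _ => b, rfl, rfl, by simp⟩
  | @head a _ hstep _ ih =>
    obtain ⟨n, f, rfl, rfl, hf⟩ := ih
    refine ⟨n + 1, fun i => Nat.casesOn i a f, rfl, rfl, fun i hi => ?_⟩
    cases i with
    | zero => exact hstep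
    | succ i => exact hf i (by omega)

section Matroid

open scoped Matroid

variable {α : Type*} (M : Matroid α)

theorem eRk_contract_add_eRk {F X : Set α} (hF : F ⊆ M.E) (hX : X ⊆ M.E) (hd : Disjoint F X) :
    (M ／ X).eRk F + M.eRk X = M.eRk (F ∪ X) := by
  obtain ⟨I, hI⟩ := M.exists_isBasis X
  obtain ⟨J, hJ, hIJ⟩ := hI.indep.subset_isBasis_of_subset
    (hI.subset.trans Set.subset_union_right) (Set.union_subset hF hX)
  have hJX : J ∩ X = I := (hI.eq_of_subset_indep (hJ.indep.inter_right X)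
    (Set.subset_inter hIJ hI.subset) Set.inter_subset_right).symm
  have hJI : J \ X ∪ I = J := by rw [← hJX, Set.sdiff_union_inter]
  have hbasis : (M ／ X).IsBasis (J \ X) F := by
    have := hJ.contract_isBasis hI (by rw [hJI]; exact hJ.indep)
    rwa [Set.union_sdiff_right, hd.sdiff_eq_left] at this
  rw [hbasis.eRk_eq_encard, hI.eRk_eq_encard, hJ.eRk_eq_encard,
    ← Set.encard_union_eq (Set.disjoint_sdiff_left.mono_right hI.subset), hJI]

open scoped Classical in
theorem sum_flatMoebius_le [M.Finite] [Fintype M.FlatType] (F : M.FlatType) :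
    ∑ F' : M.FlatType with F' ≤ F, M.flatMoebius F' = if F.1 = M.closure ∅ then 1 else 0 := by
  let _ : LocallyFiniteOrder M.FlatType := Fintype.toLocallyFiniteOrder
  have hbot (F' : M.FlatType) : (⟨M.closure ∅, M.isFlat_closure ∅⟩ : M.FlatType) ≤ F' :=
    (M.closure_subset_closure (Set.empty_subset F'.1)).trans F'.2.closure.subset
  calc ∑ F' : M.FlatType with F' ≤ F, M.flatMoebius F'
      = ∑ F' ∈ Finset.Icc (⟨M.closure ∅, M.isFlat_closure ∅⟩ : M.FlatType) F,
          IncidenceAlgebra.mu ℤ ⟨M.closure ∅, M.isFlat_closure ∅⟩ F' := by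
        refine Finset.sum_congr ?_ fun F' _ => ?_
        · ext F'
          simp [hbot F']
        · unfold Matroid.flatMoebius
          congr!
    _ = if F.1 = M.closure ∅ then 1 else 0 := by
        rw [IncidenceAlgebra.sum_Icc_mu_right]
        simp only [Subtype.ext_iff, eq_comm]

end Matroid

/-- The dimension of a subspace, as a function on the lattice of subspaces. -/
noncomputable abbrev subspaceDim {K E : Type*} [Field K] [AddCommGroup E] [Module K E]
    (P : Submodule K E) : ℕ :=
  Module.finrank K P

section

variable {K E : Type*} [Field K] [AddCommGroup E] [Module K E] [FiniteDimensional K E]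

theorem isRankFunction_subspaceDim : IsRankFunction (subspaceDim : Submodule K E → ℕ) :=
  ⟨fun _ _ => Submodule.finrank_lt_finrank_of_lt,
    fun P Q => Submodule.finrank_sup_add_finrank_inf_eq P Q⟩

theorem codim_add_subspaceDim (P : Submodule K E) :
    P.codim + subspaceDim P = subspaceDim (⊤ : Submodule K E) :=
  P.codim_add_finrank.trans (finrank_top K E).symm

theorem subspaceDim_comap {E' : Type*} [AddCommGroup E'] [Module K E'] {π : E →ₗ[K] E'}
    (hπ : Function.Surjective π) (P : Submodule K E') :
    subspaceDim (P.comap π) = subspaceDim P + subspaceDim (LinearMap.ker π) := by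
  have hker : LinearMap.ker π ≤ P.comap π := Submodule.comap_mono bot_le
  have hrank := LinearMap.finrank_range_add_finrank_ker (π.domRestrict (P.comap π))
  rw [LinearMap.range_domRestrict, Submodule.map_comap_eq_of_surjective hπ,
    LinearMap.ker_domRestrict, (Submodule.comapSubtypeEquivOfLe hker).finrank_eq] at hrank
  exact hrank.symm

end

namespace HyperplaneArrangement

open scoped Matroid

variable {K : Type*} [Field K] {E : Type*} [AddCommGroup E] [Module K E] [FiniteDimensional K E]
  (A : HyperplaneArrangement K E) {P Q : Submodule K E}

theorem subspaceDim_add_one {H : Submodule K E} (hH : H ∈ A.hyperplanes) :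
    subspaceDim H + 1 = subspaceDim (⊤ : Submodule K E) := by
  rw [← codim_add_subspaceDim H, A.codim_eq_one H hH, add_comm]

theorem matroid_indep_iff {I : Set (Submodule K E)} :
    A.matroid.Indep I ↔ I ⊆ A.hyperplanes ∧ (sInf I).codim = I.ncard := by
  simp [matroid]

theorem mem_closure_iff_of_indep {I : Set (Submodule K E)} (hI : A.matroid.Indep I)
    {H : Submodule K E} (hH : H ∈ A.hyperplanes) : H ∈ A.matroid.closure I ↔ sInf I ≤ H := by
  obtain ⟨hIA, hcodim⟩ := A.matroid_indep_iff.1 hI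
  by_cases hHI : H ∈ I
  · exact iff_of_true (A.matroid.mem_closure_of_mem' hHI hH) (sInf_le hHI)
  rw [← not_iff_not, hI.notMem_closure_iff_of_notMem hHI hH, A.matroid_indep_iff, sInf_insert,
    Set.ncard_insert_of_notMem hHI (A.finite.subset hIA), Set.insert_subset_iff]
  constructor
  · rintro ⟨-, hcodim'⟩ hle
    rw [inf_eq_right.2 hle] at hcodim'
    omega
  · intro hle
    have := Submodule.codim_inf_le H (sInf I)
    have := A.codim_eq_one H hH
    have := Submodule.codim_strictAnti (inf_lt_right.2 hle)
    exact ⟨⟨hH, hIA⟩, by omega⟩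

theorem sInf_eq_of_isBasis {I X : Set (Submodule K E)} (hI : A.matroid.IsBasis I X) :
    sInf I = sInf X := by
  refine le_antisymm (le_sInf fun H hH => ?_) (sInf_le_sInf hI.subset)
  exact (A.mem_closure_iff_of_indep hI.indep (hI.subset_ground hH)).1 (hI.subset_closure hH)

theorem closure_eq_above {X : Set (Submodule K E)} (hX : X ⊆ A.hyperplanes) :
    A.matroid.closure X = above A.hyperplanes (sInf X) := by
  obtain ⟨I, hI⟩ := A.matroid.exists_isBasis X hX
  ext H
  rw [← hI.closure_eq_closure, ← A.sInf_eq_of_isBasis hI]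
  constructor
  · intro h
    have hH : H ∈ A.hyperplanes := A.matroid.closure_subset_ground _ h
    exact ⟨hH, (A.mem_closure_iff_of_indep hI.indep hH).1 h⟩
  · exact fun h => (A.mem_closure_iff_of_indep hI.indep h.1).2 h.2

theorem natRk_eq_codim {X : Set (Submodule K E)} (hX : X ⊆ A.hyperplanes) :
    A.matroid.natRk X = (sInf X).codim := by
  obtain ⟨I, hI⟩ := A.matroid.exists_isBasis X hX
  rw [Matroid.natRk, hI.eRk_eq_encard, ← A.sInf_eq_of_isBasis hI,
    (A.matroid_indep_iff.1 hI.indep).2, Set.ncard]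

theorem natRk_contract_add_codim {X F : Set (Submodule K E)} (hX : X ⊆ A.hyperplanes)
    (hF : F ⊆ A.hyperplanes) (hd : Disjoint F X) :
    (A.matroid ／ X).natRk F + (sInf X).codim = (sInf (F ∪ X)).codim := by
  have eRk_ne_top (M : Matroid (Submodule K E)) {Y : Set (Submodule K E)}
      (hY : Y ⊆ A.hyperplanes) : M.eRk Y ≠ ⊤ :=
    ne_top_of_le_ne_top (Set.encard_ne_top_iff.2 (A.finite.subset hY)) (M.eRk_le_encard Y)
  rw [← A.natRk_eq_codim hX, ← A.natRk_eq_codim (Set.union_subset hF hX), Matroid.natRk,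
    Matroid.natRk, Matroid.natRk, ← eRk_contract_add_eRk A.matroid hF hX hd,
    ENat.toNat_add (eRk_ne_top _ hF) (eRk_ne_top _ hX)]

theorem isFlat_above (P : Submodule K E) : A.matroid.IsFlat (above A.hyperplanes P) := by
  rw [Matroid.isFlat_iff_closure_eq, A.closure_eq_above (above_subset _ P)]
  exact (above_anti _ (le_sInf_above _ P)).antisymm fun H hH => ⟨hH.1, sInf_le hH⟩

/-- The flat of the contraction `M(A) ／ above A.hyperplanes P` that corresponds to a subspace `Q`
of `P`. -/
def contractFlat (hQP : Q ≤ P) : (A.matroid ／ above A.hyperplanes P).FlatType :=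
  ⟨above A.hyperplanes Q \ above A.hyperplanes P, by
    rw [Matroid.isFlat_iff_closure_eq, Matroid.contract_closure_eq,
      Set.sdiff_union_of_subset (above_anti _ hQP), (A.isFlat_above Q).closure]⟩

section Contract

variable (F : (A.matroid ／ above A.hyperplanes P).FlatType)

theorem subset_hyperplanes_and_disjoint :
    F.1 ⊆ A.hyperplanes ∧ Disjoint F.1 (above A.hyperplanes P) :=
  Set.subset_sdiff.1 F.2.subset_ground

theorem sInf_contract_mem : sInf (F.1 ∪ above A.hyperplanes P) ∈ intersections A.finite :=
  sInf_mem_intersections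
    (Set.union_subset (A.subset_hyperplanes_and_disjoint F).1 (above_subset _ P))

theorem sInf_contract_le (hP : P ∈ intersections A.finite) :
    sInf (F.1 ∪ above A.hyperplanes P) ≤ P :=
  (sInf_le_sInf Set.subset_union_right).trans (sInf_above_eq hP).le

theorem le_sInf_contract_iff (hQP : Q ≤ P) :
    Q ≤ sInf (F.1 ∪ above A.hyperplanes P) ↔ F ≤ A.contractFlat hQP := by
  obtain ⟨hF, hdisj⟩ := A.subset_hyperplanes_and_disjoint F
  rw [sInf_union, le_inf_iff, and_iff_left (hQP.trans (le_sInf_above _ P)), le_sInf_iff]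
  exact ⟨fun h H hH => ⟨⟨hF hH, h H hH⟩, hdisj.notMem_of_mem_left hH⟩, fun h H hH => (h hH).1.2⟩

theorem natRk_contract_sub_natRk :
    (A.matroid ／ above A.hyperplanes P).natRk (A.matroid ／ above A.hyperplanes P).E -
        (A.matroid ／ above A.hyperplanes P).natRk F.1 =
      subspaceDim (sInf (F.1 ∪ above A.hyperplanes P)) - subspaceDim (sInf A.hyperplanes) := by
  obtain ⟨hF, hdisj⟩ := A.subset_hyperplanes_and_disjoint F
  have hrankF := A.natRk_contract_add_codim (above_subset _ P) hF hdisj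
  have hrankE := A.natRk_contract_add_codim (above_subset _ P)
    (F := A.hyperplanes \ above A.hyperplanes P) Set.sdiff_subset Set.disjoint_sdiff_left
  rw [Set.sdiff_union_of_subset (above_subset _ P)] at hrankE
  have hdimE := codim_add_subspaceDim (sInf A.hyperplanes)
  have hdimF := codim_add_subspaceDim (sInf (F.1 ∪ above A.hyperplanes P))
  rw [show (A.matroid ／ above A.hyperplanes P).E = A.hyperplanes \ above A.hyperplanes P from rfl]
  omega

open scoped Classical in
theorem sum_flatMoebius_le_sInf_contract [Fintype (A.matroid ／ above A.hyperplanes P).FlatType]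
    (hQ : Q ∈ intersections A.finite) (hQP : Q ≤ P) :
    ∑ F : (A.matroid ／ above A.hyperplanes P).FlatType
      with Q ≤ sInf (F.1 ∪ above A.hyperplanes P),
        (A.matroid ／ above A.hyperplanes P).flatMoebius F = if Q = P then 1 else 0 := by
  have hbot : (A.contractFlat hQP).1 = (A.matroid ／ above A.hyperplanes P).closure ∅ ↔ Q = P := by
    rw [Matroid.contract_closure_eq, Set.empty_union, (A.isFlat_above P).closure, Set.sdiff_self,
      contractFlat, Set.sdiff_eq_empty]
    constructor
    · exact fun h => hQP.antisymm ((le_sInf_above _ P).trans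
        ((sInf_le_sInf h).trans (sInf_above_eq hQ).le))
    · rintro rfl
      exact subset_rfl
  simp only [A.le_sInf_contract_iff _ hQP, sum_flatMoebius_le, hbot]

end Contract

theorem charPoly_contract_above (hP : P ∈ intersections A.finite) :
    (A.matroid ／ above A.hyperplanes P).charPoly =
      relCharPoly (intersections A.finite) subspaceDim (sInf A.hyperplanes) P := by
  let _ := Fintype.ofFinite (A.matroid ／ above A.hyperplanes P).FlatType
  rw [Matroid.charPoly, ← sum_moebius_mul_pow_eq_relCharPoly hP (sInf_le_of_mem_intersections hP)
    (fun F => ⟨A.sInf_contract_mem F, sInf_le_of_mem_intersections (A.sInf_contract_mem F),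
      A.sInf_contract_le F hP⟩)
    fun Q hQ _ hQP => A.sum_flatMoebius_le_sInf_contract hQ hQP]
  exact Finset.sum_congr rfl fun F _ => by rw [A.natRk_contract_sub_natRk F]

theorem isDivisionallyFree_of_divisionalChain
    (h : DivisionalChain (intersections A.finite) subspaceDim (sInf A.hyperplanes) ⊤
      (sInf A.hyperplanes)) : A.IsDivisionallyFree := by
  obtain ⟨n, f, hf₀, hfn, hstep⟩ := exists_fun_of_reflTransGen h
  have hmem : ∀ i ≤ n, f i ∈ intersections A.finite
    | 0, _ => hf₀ ▸ top_mem_intersections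
    | i + 1, hi => (hstep i hi).mem
  have hcodim : ∀ i ≤ n, (f i).codim = i := by
    intro i hi
    suffices subspaceDim (f i) + i = subspaceDim (⊤ : Submodule K E) by
      have := codim_add_subspaceDim (f i)
      omega
    induction i with
    | zero => simp [hf₀]
    | succ i ih => rw [← ih (by omega), (hstep i hi).rank_eq, add_assoc, add_comm 1]
  have hrank : A.matroid.natRk A.matroid.E = n := by
    rw [← hcodim n le_rfl, hfn]
    exact A.natRk_eq_codim subset_rfl
  unfold IsDivisionallyFree Matroid.HasDivisionalFlag
  rw [hrank]
  refine ⟨fun i => above A.hyperplanes (f i), ?_, ?_, fun i hi => ⟨A.isFlat_above _, ?_⟩,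
    fun i hi => ⟨above_anti _ (hstep i hi).le, ?_⟩⟩
  · refine Set.eq_empty_of_forall_notMem fun H ⟨hH, hle⟩ => ?_
    exact (isRankFunction_subspaceDim.isCoatom_of_add_one_eq (A.subspaceDim_add_one hH)).1
      (top_le_iff.1 (hf₀ ▸ hle))
  · exact (above_subset _ _).antisymm fun H hH => ⟨hH, hfn ▸ sInf_le hH⟩
  · rw [A.natRk_eq_codim (above_subset _ _), sInf_above_eq (hmem i hi), hcodim i hi]
  · rw [A.charPoly_contract_above (hmem i hi.le), A.charPoly_contract_above (hmem (i + 1) hi)]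
    exact (hstep i hi).dvd

end HyperplaneArrangement

/-! ### Simplicial vertices of chordal graphs -/

section ChordalGraph

open SimpleGraph

variable {V : Type*} {G : SimpleGraph V}

theorem isChordless_of_length_eq_dist {x y : V} {p : G.Walk x y} (hp : p.length = G.dist x y) :
    p.IsChordless := by
  classical
  have mem_edges {s t : V} {q : G.Walk s t} (hq : q.IsSubwalk p) (hst : G.Adj s t) :
      s(s, t) ∈ p.edges := by
    have hlength : q.length = 1 :=
      (length_eq_dist_of_subwalk hp hq).trans (dist_eq_one_iff_adj.2 hst)
    match q, hlength with
    | .cons _ .nil, _ => exact hq.edges_subset (by simp)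
  refine Walk.isChordless_iff_forall_mem_edges.2 fun s t hs ht hst => ?_
  by_cases h : t ∈ (p.dropUntil s hs).support
  · exact mem_edges (((p.dropUntil s hs).isSubwalk_takeUntil h).trans
      (p.isSubwalk_dropUntil hs)) hst
  · rw [← p.take_spec hs, Walk.mem_support_append_iff] at ht
    have h' := ht.resolve_right h
    rw [Sym2.eq_swap]
    exact mem_edges (((p.takeUntil s hs).isSubwalk_dropUntil h').trans
      (p.isSubwalk_takeUntil hs)) hst.symm

theorem exists_isPath_isChordless {D : Set V} {x y : V} (p : G.Walk x y)
    (hp : ∀ z ∈ p.support, z ∈ D) :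
    ∃ q : G.Walk x y, q.IsPath ∧ q.IsChordless ∧ ∀ z ∈ q.support, z ∈ D := by
  obtain ⟨q, hq⟩ := (p.induce D hp).reachable.exists_walk_length_eq_dist
  have hsupport : ∀ z ∈ (q.map (Embedding.induce D).toHom).support, z ∈ D := fun z hz => by
    rw [Walk.support_map, List.mem_map] at hz
    obtain ⟨z, -, rfl⟩ := hz
    exact z.2
  have hchordless : (q.map (Embedding.induce D).toHom).IsChordless := by
    refine Walk.isChordless_iff_forall_mem_edges.2 fun s t hs ht hst => ?_
    rw [Walk.support_map, List.mem_map] at hs ht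
    obtain ⟨s, hs, rfl⟩ := hs
    obtain ⟨t, ht, rfl⟩ := ht
    rw [Walk.edges_map, List.mem_map]
    exact ⟨s(s, t), (isChordless_of_length_eq_dist hq).mem_edges hs ht hst, rfl⟩
  exact ⟨q.map (Embedding.induce D).toHom,
    (q.isPath_of_length_eq_dist hq).map Subtype.val_injective, hchordless, hsupport⟩

theorem isCycle_cons_concat {a x y : V} {q : G.Walk x y} (hq : q.IsPath) (ha : a ∉ q.support)
    (hxy : x ≠ y) (hax : G.Adj a x) (hya : G.Adj y a) :
    (Walk.cons hax (q.concat hya)).IsCycle := by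
  refine (Walk.cons_isCycle_iff _ _).2 ⟨hq.concat ha hya, fun h => ?_⟩
  rw [Walk.edges_concat, List.concat_eq_append, List.mem_append, List.mem_singleton] at h
  rcases h with h | h
  · exact ha (q.fst_mem_support_of_mem_edges h)
  · rcases Sym2.eq_iff.1 h with ⟨hay, -⟩ | ⟨-, hxy'⟩
    · exact hya.ne hay.symm
    · exact hxy hxy'

theorem isChordless_cons_concat {a x y : V} {q : G.Walk x y} (hq : q.IsChordless)
    (hax : G.Adj a x) (hya : G.Adj y a) (ha : ∀ z ∈ q.support, G.Adj a z → z = x ∨ z = y) :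
    (Walk.cons hax (q.concat hya)).IsChordless := by
  have hcone : ∀ z ∈ q.support, G.Adj a z → s(a, z) ∈ (Walk.cons hax (q.concat hya)).edges := by
    intro z hz haz
    rcases ha z hz haz with rfl | rfl <;> simp [Walk.edges_concat, Sym2.eq_swap]
  refine Walk.isChordless_iff_forall_mem_edges.2 fun s t hs ht hst => ?_
  simp only [Walk.support_cons, Walk.support_concat, List.mem_cons, List.mem_append,
    List.not_mem_nil, or_false] at hs ht
  have hs' : s = a ∨ s ∈ q.support := by tauto
  have ht' : t = a ∨ t ∈ q.support := by tauto
  rcases hs' with rfl | hs' <;> rcases ht' with rfl | ht'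
  · exact absurd hst G.irrefl
  · exact hcone t ht' hst
  · exact Sym2.eq_swap ▸ hcone s hs' hst.symm
  · simp [Walk.edges_concat, hq.mem_edges hs' ht' hst]

/-- Otherwise a shortest walk from `x` to `y` through vertices that are neither `a` nor adjacent to
`a` would close up through `a` to a cycle without chords. -/
theorem adj_of_isChordalGraph_of_walk (hG : G.IsChordalGraph) {a x y c d : V}
    (hax : G.Adj a x) (hay : G.Adj a y) (hxc : G.Adj x c) (hyd : G.Adj y d) (hxy : x ≠ y)
    (p : G.Walk c d) (hp : ∀ z ∈ p.support, z ≠ a ∧ ¬ G.Adj a z) : G.Adj x y := by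
  by_contra hnadj
  obtain ⟨q, hpath, hchordless, hq⟩ :=
    exists_isPath_isChordless (D := {z | z ≠ a ∧ (G.Adj a z → z = x ∨ z = y)})
      (.cons hxc (p.concat hyd.symm)) fun z hz => by
        simp only [Walk.support_cons, Walk.support_concat, List.mem_cons, List.mem_append,
          List.not_mem_nil, or_false] at hz
        rcases hz with rfl | hz | rfl
        · exact ⟨hax.ne', fun _ => .inl rfl⟩
        · exact ⟨(hp z hz).1, fun haz => absurd haz (hp z hz).2⟩
        · exact ⟨hay.ne', fun _ => .inr rfl⟩
  have hlength : 2 ≤ q.length := by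
    by_contra! hlt
    have : q.length = 0 ∨ q.length = 1 := by omega
    rcases this with h | h
    · exact hxy (Walk.eq_of_length_eq_zero h)
    · exact hnadj (Walk.adj_of_length_eq_one h)
  obtain ⟨s, hs, t, ht, hst, hchord⟩ := hG a _
    (isCycle_cons_concat hpath (fun ha => (hq a ha).1 rfl) hxy hax hay.symm)
    (by rw [Walk.length_cons, Walk.length_concat]; omega)
  exact hchord <| (isChordless_cons_concat hchordless hax hay.symm
    fun z hz => (hq z hz).2).mem_edges hs ht hst

variable (G) in
/-- A vertex `a` is simplicial in `U` if its neighbours in `U` are pairwise adjacent. -/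
def IsSimplicialIn (U : Set V) (a : V) : Prop :=
  G.IsClique (U ∩ G.neighborSet a)

theorem exists_clique_le_closedNeighborhood {U Q : Set V} (hU : ¬ G.IsClique U)
    (hQ : G.IsClique Q) :
    ∃ a ∈ U, ∃ b ∈ U, b ≠ a ∧ ¬ G.Adj a b ∧ ∀ q ∈ Q, q ∈ U → q = a ∨ G.Adj a q := by
  by_cases hQU : ∃ a ∈ Q, a ∈ U ∧ ∃ b ∈ U, b ≠ a ∧ ¬ G.Adj a b
  · obtain ⟨a, haQ, ha, b, hb, hba, hab⟩ := hQU
    exact ⟨a, ha, b, hb, hba, hab, fun q hq _ => or_iff_not_imp_left.2 fun hqa =>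
      hQ haQ hq (Ne.symm hqa)⟩
  · simp only [IsClique, Set.Pairwise] at hU
    push Not at hQU hU
    obtain ⟨a, ha, b, hb, hab, hnadj⟩ := hU
    exact ⟨a, ha, b, hb, hab.symm, hnadj, fun q hq hqU => or_iff_not_imp_left.2 fun hqa =>
      (hQU q hq hqU a ha (Ne.symm hqa)).symm⟩

/-- Dirac's theorem. The clique `Q` is carried along for the induction: cutting along the
neighbourhood of a vertex `a` leaves a component `C` of its complement whose boundary `B` is a
clique, and a simplicial vertex of `C ∪ B` that lies outside `B` is simplicial in `U`. -/
theorem exists_isSimplicialIn_notMem (hG : G.IsChordalGraph) (U : Finset V) {Q : Set V}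
    (hQ : G.IsClique Q) (hUQ : ∃ u ∈ U, u ∉ Q) : ∃ a ∈ U, a ∉ Q ∧ IsSimplicialIn G U a := by
  classical
  induction U using Finset.strongInduction generalizing Q with
  | H U ih =>
  obtain ⟨u, hu, huQ⟩ := hUQ
  by_cases hU : G.IsClique (U : Set V)
  · exact ⟨u, hu, huQ, hU.subset Set.inter_subset_left⟩
  obtain ⟨a, ha, b, hb, hba, hab, hQa⟩ := exists_clique_le_closedNeighborhood hU hQ
  let C : Set V := {c | ∃ p : G.Walk b c, ∀ z ∈ p.support, z ∈ U ∧ z ≠ a ∧ ¬ G.Adj a z}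
  let B : Set V := {x | G.Adj a x ∧ ∃ c ∈ C, G.Adj x c}
  have hbC : b ∈ C := ⟨.nil, by simp_all⟩
  have hC : ∀ c ∈ C, c ≠ a ∧ ¬ G.Adj a c := fun c ⟨p, hp⟩ => (hp c p.end_mem_support).2
  have hB : G.IsClique B := by
    rintro x ⟨hax, c, ⟨p, hp⟩, hxc⟩ y ⟨hay, d, ⟨q, hq⟩, hyd⟩ hxy
    refine adj_of_isChordalGraph_of_walk hG hax hay hxc hyd hxy (p.reverse.append q) fun z hz => ?_
    rw [Walk.mem_support_append_iff, Walk.support_reverse, List.mem_reverse] at hz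
    exact hz.elim (fun hz => (hp z hz).2) fun hz => (hq z hz).2
  have hneighbor : ∀ c ∈ C, ∀ x ∈ U, G.Adj c x → x ∈ C ∨ x ∈ B := by
    rintro c ⟨p, hp⟩ x hx hcx
    by_cases hax : G.Adj a x
    · exact .inr ⟨hax, c, ⟨p, hp⟩, hcx.symm⟩
    · refine .inl ⟨p.concat hcx, fun z hz => ?_⟩
      rw [Walk.support_concat, List.mem_append, List.mem_singleton] at hz
      rcases hz with hz | rfl
      · exact hp z hz
      · exact ⟨hx, fun hza => (hC c ⟨p, hp⟩).2 (hza ▸ hcx.symm), hax⟩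
  have hssubset : U.filter (fun x => x ∈ C ∨ x ∈ B) ⊂ U :=
    Finset.filter_ssubset.2 ⟨a, ha, fun h => h.elim (fun h => (hC a h).1 rfl) fun h => G.irrefl h.1⟩
  obtain ⟨v, hv, hvB, hsimplicial⟩ :=
    ih _ hssubset hB ⟨b, Finset.mem_filter.2 ⟨hb, .inl hbC⟩, fun h => hab h.1⟩
  rw [Finset.mem_filter] at hv
  have hvC : v ∈ C := hv.2.resolve_right hvB
  have hneighbors : (U : Set V) ∩ G.neighborSet v ⊆ U.filter (fun x => x ∈ C ∨ x ∈ B) :=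
    fun x hx => Finset.mem_coe.2 (Finset.mem_filter.2 ⟨hx.1, hneighbor v hvC x hx.1 hx.2⟩)
  exact ⟨v, hv.1, fun hvQ => (hQa v hvQ hv.1).elim (hC v hvC).1 (hC v hvC).2,
    IsClique.subset (Set.subset_inter hneighbors Set.inter_subset_right) hsimplicial⟩

variable (G) in
/-- Every nonempty set of vertices has a vertex that is simplicial in it: the graph has a perfect
elimination order, and so does each of its induced subgraphs. -/
def HasSimplicialVertices : Prop :=
  ∀ U : Finset V, U.Nonempty → ∃ a ∈ U, IsSimplicialIn G U a

theorem hasSimplicialVertices_of_isChordalGraph (hG : G.IsChordalGraph) :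
    HasSimplicialVertices G := by
  rintro U ⟨u, hu⟩
  obtain ⟨a, ha, -, h⟩ :=
    exists_isSimplicialIn_notMem hG U (Q := ∅) (by simp) ⟨u, hu, Set.notMem_empty u⟩
  exact ⟨a, ha, h⟩

theorem hasSimplicialVertices_top : HasSimplicialVertices (⊤ : SimpleGraph V) :=
  fun _ ⟨a, ha⟩ => ⟨a, ha, fun _ _ _ _ hbc => hbc⟩

/-- The graph `G` with a new vertex `none` that is joined to the vertices in `S`. -/
def adjoinVertex (G : SimpleGraph V) (S : Set V) : SimpleGraph (Option V) where
  Adj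
    | some a, some b => G.Adj a b
    | some a, none => a ∈ S
    | none, some b => b ∈ S
    | none, none => False
  symm := ⟨by rintro (_ | a) (_ | b) h <;> first | exact h | exact Adj.symm h⟩
  loopless := ⟨by rintro (_ | a) h <;> first | exact h | exact G.irrefl h⟩

theorem HasSimplicialVertices.adjoinVertex (hG : HasSimplicialVertices G) {S : Set V}
    (hS : G.IsClique S) : HasSimplicialVertices (adjoinVertex G S) := by
  intro U hU
  by_cases hnone : none ∈ U
  · refine ⟨none, hnone, ?_⟩
    rintro (_ | b) ⟨_, hb⟩ (_ | c) ⟨_, hc⟩ hbc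
    · exact absurd rfl hbc
    · exact hc
    · exact hb
    · exact hS hb hc fun h => hbc (congrArg some h)
  · have hU' : (Finset.eraseNone U).Nonempty := by
      obtain ⟨_ | a, ha⟩ := hU
      · exact absurd ha hnone
      · exact ⟨a, Finset.mem_eraseNone.2 ha⟩
    obtain ⟨a, ha, hsimplicial⟩ := hG _ hU'
    refine ⟨some a, Finset.mem_eraseNone.1 ha, ?_⟩
    rintro (_ | b) ⟨hb, hab⟩ (_ | c) ⟨hc, hac⟩ hbc
    · exact absurd rfl hbc
    · exact absurd hb hnone
    · exact absurd hc hnone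
    · exact hsimplicial ⟨Finset.mem_eraseNone.2 hb, hab⟩ ⟨Finset.mem_eraseNone.2 hc, hac⟩
        fun h => hbc (congrArg some h)

end ChordalGraph

/-! ### Graphic arrangements -/

section GraphicArrangement

variable {K : Type*} [Field K] {E : Type*} [AddCommGroup E] [Module K E] {W : Type*}
  {G : SimpleGraph W} {φ : W → E →ₗ[K] K} {U : Set W} {a : W}

/-- Every form of the family can be separated from all the others: at a suitable vector it takes
a value that differs from the common value of the others. The differences `φ a - φ b` then have
the same linear dependencies as the differences of coordinates. -/
def IsSeparatedFamily (φ : W → E →ₗ[K] K) : Prop :=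
  ∀ a, ∃ (z : E) (c : K), φ a z ≠ c ∧ ∀ b ≠ a, φ b z = c

variable (G φ U) in
/-- The graphic arrangement of the subgraph of `G` induced on `U`, realized by the forms `φ`. -/
def graphicHyperplanes : Set (Submodule K E) :=
  {H | ∃ a ∈ U, ∃ b ∈ U, G.Adj a b ∧ H = LinearMap.ker (φ a - φ b)}

theorem ker_sub_comm (α β : E →ₗ[K] K) : LinearMap.ker (α - β) = LinearMap.ker (β - α) := by
  rw [← neg_sub, LinearMap.ker_neg]

theorem inf_ker_sub_le (α β γ : E →ₗ[K] K) :
    LinearMap.ker (α - β) ⊓ LinearMap.ker (α - γ) ≤ LinearMap.ker (β - γ) := by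
  rintro x ⟨hβ, hγ⟩
  simp only [SetLike.mem_coe, LinearMap.mem_ker, LinearMap.sub_apply] at hβ hγ ⊢
  linear_combination hγ - hβ

theorem exists_eq_ker_of_mem_graphicHyperplanes {H : Submodule K E}
    (hH : H ∈ graphicHyperplanes G φ U) (hH' : H ∉ graphicHyperplanes G φ (U \ {a})) :
    ∃ b ∈ U, G.Adj a b ∧ H = LinearMap.ker (φ a - φ b) := by
  obtain ⟨c, hc, d, hd, hcd, rfl⟩ := hH
  obtain rfl | hca := eq_or_ne c a
  · exact ⟨d, hd, hcd, rfl⟩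
  obtain rfl | hda := eq_or_ne d a
  · exact ⟨c, hc, hcd.symm, ker_sub_comm _ _⟩
  · exact absurd ⟨c, ⟨hc, hca⟩, d, ⟨hd, hda⟩, hcd, rfl⟩ hH'

theorem IsSeparatedFamily.sub_ne_zero (hφ : IsSeparatedFamily φ) {a b : W} (hab : a ≠ b) :
    φ a - φ b ≠ 0 := by
  obtain ⟨z, c, hz, hz'⟩ := hφ a
  intro h
  have hab' := LinearMap.congr_fun h z
  rw [LinearMap.sub_apply, hz' b hab.symm, LinearMap.zero_apply, sub_eq_zero] at hab'
  exact hz hab'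

variable [FiniteDimensional K E]

theorem subspaceDim_ker_add_one {ψ : E →ₗ[K] K} (hψ : ψ ≠ 0) :
    subspaceDim (LinearMap.ker ψ) + 1 = subspaceDim (⊤ : Submodule K E) := by
  rw [← codim_add_subspaceDim (LinearMap.ker ψ), LinearMap.codim_ker_eq_one ψ hψ, add_comm]

theorem IsSimplicialIn.isModularCoatomIn_graphicHyperplanes (hφ : IsSeparatedFamily φ)
    (ha : IsSimplicialIn G U a) :
    IsModularCoatomIn subspaceDim (graphicHyperplanes G φ (U \ {a}))
      (graphicHyperplanes G φ U) where
  subset := by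
    rintro H ⟨c, hc, d, hd, hcd, rfl⟩
    exact ⟨c, hc.1, d, hd.1, hcd, rfl⟩
  rank_add_one := by
    rintro H ⟨c, -, d, -, hcd, rfl⟩
    exact subspaceDim_ker_add_one (hφ.sub_ne_zero hcd.ne)
  not_le := by
    intro H hH hH' hle
    obtain ⟨b, -, hab, rfl⟩ := exists_eq_ker_of_mem_graphicHyperplanes hH hH'
    obtain ⟨z, c, hz, hz'⟩ := hφ a
    have hmem : z ∈ sInf (graphicHyperplanes G φ (U \ {a})) := by
      rw [Submodule.mem_sInf]
      rintro H ⟨s, hs, t, ht, -, rfl⟩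
      rw [LinearMap.mem_ker, LinearMap.sub_apply, hz' s hs.2, hz' t ht.2, sub_self]
    have hker := hle hmem
    rw [LinearMap.mem_ker, LinearMap.sub_apply, hz' b hab.ne', sub_eq_zero] at hker
    exact hz hker
  exists_line := by
    intro e he he' f hf hf' hef
    obtain ⟨b, hb, hab, rfl⟩ := exists_eq_ker_of_mem_graphicHyperplanes he he'
    obtain ⟨c, hc, hac, rfl⟩ := exists_eq_ker_of_mem_graphicHyperplanes hf hf'
    have hbc : b ≠ c := fun h => hef (h ▸ rfl)
    refine ⟨_, ⟨b, ⟨hb, hab.ne'⟩, c, ⟨hc, hac.ne'⟩, ha ⟨hb, hab⟩ ⟨hc, hac⟩ hbc, rfl⟩,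
      inf_ker_sub_le _ _ _, ?_⟩
    rw [ker_sub_comm (φ a) (φ b)]
    exact inf_ker_sub_le _ _ _

/-- Removing simplicial vertices one after the other removes modular coatoms. -/
theorem divisionalChain_graphicHyperplanes (hφ : IsSeparatedFamily φ)
    (hG : HasSimplicialVertices G) (U : Finset W) (h : (graphicHyperplanes G φ U).Finite) :
    DivisionalChain (intersections h) subspaceDim (sInf (graphicHyperplanes G φ U)) ⊤
      (sInf (graphicHyperplanes G φ U)) := by
  classical
  induction U using Finset.strongInduction with
  | H U ih =>
    obtain rfl | hU := U.eq_empty_or_nonempty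
    · have hempty : graphicHyperplanes G φ ((∅ : Finset W) : Set W) = ∅ := by
        simp [graphicHyperplanes]
      simp only [hempty, sInf_empty]
      rfl
    · obtain ⟨a, ha, hsimplicial⟩ := hG U hU
      have hm := hsimplicial.isModularCoatomIn_graphicHyperplanes hφ
      rw [← Finset.coe_erase] at hm
      exact hm.divisionalChain_top isRankFunction_subspaceDim
        (ih _ (Finset.erase_ssubset ha) (h.subset hm.subset))

end GraphicArrangement

/-! ### Gluing along full cliques -/

namespace GainGraph

variable {V : Type u} {K : Type v} [Field K] {G : Subgroup Kˣ}

/-- The subspace of the vectors that vanish on `W`. -/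
def vanishing (K : Type v) [Field K] (W : Set V) : Submodule K (V → K) :=
  ⨅ a ∈ W, LinearMap.ker (LinearMap.proj a)

/-- The hyperplanes of the edges and loops of `Γ` within `U`: the frame arrangement of `Γ[U]`, as an
arrangement in `K^V`. -/
def hyperplanesIn (Γ : GainGraph V G) (U : Set V) : Set (Submodule K (V → K)) :=
  {H | ∃ (a b : V) (g : G), a ∈ U ∧ b ∈ U ∧ Γ.Edge a b g ∧
      H = LinearMap.ker (edgeForm a b (g : Kˣ))} ∪
    {H | ∃ a, a ∈ U ∧ a ∈ Γ.Loops ∧ H = LinearMap.ker (LinearMap.proj a : (V → K) →ₗ[K] K)}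

/-- A set `W` of vertices with loops that are joined by all possible edges: those `W` for which
`Γ[W]` is isomorphic to `K_n^G` with all loops. -/
structure IsFullClique (Γ : GainGraph V G) (W : Set V) : Prop where
  loop : ∀ a ∈ W, a ∈ Γ.Loops
  edge : ∀ a ∈ W, ∀ b ∈ W, a ≠ b → ∀ g, Γ.Edge a b g

/-- `Γ` is the union of its parts within `V₁` and `V₂`, which meet in a full clique. -/
structure IsGlued (Γ : GainGraph V G) (V₁ V₂ : Set V) : Prop where
  union_eq : V₁ ∪ V₂ = Set.univ
  edge : ∀ a b g, Γ.Edge a b g → (a ∈ V₁ ∧ b ∈ V₁) ∨ (a ∈ V₂ ∧ b ∈ V₂)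
  clique : Γ.IsFullClique (V₁ ∩ V₂)

section EdgeForm

variable {a b c : V} {g h : Kˣ} {x : V → K}

theorem mem_ker_edgeForm : x ∈ LinearMap.ker (edgeForm a b g) ↔ x a = g * x b := by
  simp [edgeForm, LinearMap.mem_ker, sub_eq_zero]

theorem mem_ker_proj :
    x ∈ LinearMap.ker (LinearMap.proj a : (V → K) →ₗ[K] K) ↔ x a = 0 := by
  rw [LinearMap.mem_ker, LinearMap.proj_apply]

theorem ker_edgeForm_symm (a b : V) (g : Kˣ) :
    LinearMap.ker (edgeForm (K := K) a b g) = LinearMap.ker (edgeForm b a g⁻¹) := by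
  ext x
  rw [mem_ker_edgeForm, mem_ker_edgeForm, ← Units.inv_mul_eq_iff_eq_mul, eq_comm]

theorem ker_edgeForm_inf_ker_edgeForm_le (a b c : V) (g h : Kˣ) :
    LinearMap.ker (edgeForm (K := K) a b g) ⊓ LinearMap.ker (edgeForm b c h) ≤
      LinearMap.ker (edgeForm a c (g * h)) := by
  rintro x ⟨hx, hx'⟩
  simp only [SetLike.mem_coe, mem_ker_edgeForm] at hx hx' ⊢
  rw [hx, hx', Units.val_mul, mul_assoc]

theorem ker_edgeForm_inf_ker_edgeForm_le_ker_proj (a b : V) (hgh : g ≠ h) :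
    LinearMap.ker (edgeForm (K := K) a b g) ⊓ LinearMap.ker (edgeForm a b h) ≤
      LinearMap.ker (LinearMap.proj b) := by
  rintro x ⟨hx, hx'⟩
  simp only [SetLike.mem_coe, mem_ker_edgeForm, mem_ker_proj] at hx hx' ⊢
  have : ((g : K) - h) * x b = 0 := by rw [sub_mul, ← hx, ← hx', sub_self]
  exact (mul_eq_zero.1 this).resolve_left fun h0 => hgh (Units.ext (sub_eq_zero.1 h0))

theorem ker_edgeForm_inf_ker_proj (a b : V) (g : Kˣ) :
    LinearMap.ker (edgeForm (K := K) a b g) ⊓ LinearMap.ker (LinearMap.proj a) =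
      LinearMap.ker (edgeForm a b g) ⊓ LinearMap.ker (LinearMap.proj b) := by
  ext x
  simp only [Submodule.mem_inf, mem_ker_edgeForm, mem_ker_proj]
  refine and_congr_right fun hx => ?_
  rw [hx, mul_eq_zero, or_iff_right (Units.ne_zero g)]

theorem ker_proj_inf_ker_proj_le (a b : V) (g : Kˣ) :
    LinearMap.ker (LinearMap.proj a : (V → K) →ₗ[K] K) ⊓ LinearMap.ker (LinearMap.proj b) ≤
      LinearMap.ker (edgeForm a b g) := by
  rintro x ⟨ha, hb⟩
  simp only [SetLike.mem_coe, mem_ker_edgeForm, mem_ker_proj] at ha hb ⊢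
  rw [ha, hb, mul_zero]

end EdgeForm

section HyperplanesIn

variable {Γ : GainGraph V G} {U V₁ V₂ W : Set V} {H : Submodule K (V → K)} {a b : V} {g : G}

theorem mem_vanishing {x : V → K} : x ∈ vanishing K W ↔ ∀ a ∈ W, x a = 0 := by
  simp [vanishing, Submodule.mem_iInf]

theorem vanishing_insert (a : V) (W : Set V) :
    vanishing K (insert a W) = LinearMap.ker (LinearMap.proj a) ⊓ vanishing K W :=
  iInf_insert

theorem Edge.ne (h : Γ.Edge a b g) : a ≠ b := by
  rintro rfl
  exact Γ.irrefl a g h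

theorem edge_mem_hyperplanesIn (ha : a ∈ U) (hb : b ∈ U) (h : Γ.Edge a b g) :
    LinearMap.ker (edgeForm a b (g : Kˣ)) ∈ Γ.hyperplanesIn U :=
  Or.inl ⟨a, b, g, ha, hb, h, rfl⟩

theorem loop_mem_hyperplanesIn (ha : a ∈ U) (h : a ∈ Γ.Loops) :
    LinearMap.ker (LinearMap.proj a : (V → K) →ₗ[K] K) ∈ Γ.hyperplanesIn U :=
  Or.inr ⟨a, ha, h, rfl⟩

theorem edge_mem_frameHyperplanes (h : Γ.Edge a b g) :
    LinearMap.ker (edgeForm a b (g : Kˣ)) ∈ Γ.frameHyperplanes :=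
  Or.inl ⟨a, b, g, h, rfl⟩

theorem loop_mem_frameHyperplanes (h : a ∈ Γ.Loops) :
    LinearMap.ker (LinearMap.proj a : (V → K) →ₗ[K] K) ∈ Γ.frameHyperplanes :=
  Or.inr ⟨a, h, rfl⟩

theorem hyperplanesIn_subset (Γ : GainGraph V G) (U : Set V) :
    Γ.hyperplanesIn U ⊆ Γ.frameHyperplanes := by
  rintro H (⟨a, b, g, -, -, h, rfl⟩ | ⟨a, -, h, rfl⟩)
  · exact edge_mem_frameHyperplanes h
  · exact loop_mem_frameHyperplanes h

theorem hyperplanesIn_mono (Γ : GainGraph V G) : Monotone Γ.hyperplanesIn := by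
  rintro U U' hU H (⟨a, b, g, ha, hb, h, rfl⟩ | ⟨a, ha, h, rfl⟩)
  · exact edge_mem_hyperplanesIn (hU ha) (hU hb) h
  · exact loop_mem_hyperplanesIn (hU ha) h

theorem mem_congr_of_mem_hyperplanesIn (hH : H ∈ Γ.hyperplanesIn U) {x y : V → K}
    (hxy : ∀ a ∈ U, x a = y a) : x ∈ H ↔ y ∈ H := by
  rcases hH with (⟨a, b, g, ha, hb, -, rfl⟩ | ⟨a, ha, -, rfl⟩)
  · rw [mem_ker_edgeForm, mem_ker_edgeForm, hxy a ha, hxy b hb]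
  · rw [mem_ker_proj, mem_ker_proj, hxy a ha]

theorem vanishing_le_sInf_hyperplanesIn (Γ : GainGraph V G) (U : Set V) :
    vanishing K U ≤ sInf (Γ.hyperplanesIn U) :=
  le_sInf fun H hH _ hx => (mem_congr_of_mem_hyperplanesIn hH (mem_vanishing.1 hx)).2 H.zero_mem

theorem mem_of_vanishing_le_ker_proj
    (h : vanishing K U ≤ LinearMap.ker (LinearMap.proj a : (V → K) →ₗ[K] K)) : a ∈ U := by
  classical
  by_contra ha
  have hsingle : (Pi.single a 1 : V → K) ∈ vanishing K U :=
    mem_vanishing.2 fun c hc => Pi.single_eq_of_ne (ne_of_mem_of_not_mem hc ha) _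
  simpa using mem_ker_proj.1 (h hsingle)

theorem mem_of_vanishing_le_ker_edgeForm {k : Kˣ} (hab : a ≠ b)
    (h : vanishing K U ≤ LinearMap.ker (edgeForm a b k)) : b ∈ U := by
  classical
  by_contra hb
  have hsingle : (Pi.single b 1 : V → K) ∈ vanishing K U :=
    mem_vanishing.2 fun c hc => Pi.single_eq_of_ne (ne_of_mem_of_not_mem hc hb) _
  simpa [Pi.single_eq_of_ne hab, eq_comm] using mem_ker_edgeForm.1 (h hsingle)

theorem mem_hyperplanesIn_of_vanishing_le (hH : H ∈ Γ.frameHyperplanes)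
    (hle : vanishing K U ≤ H) : H ∈ Γ.hyperplanesIn U := by
  rcases hH with (⟨a, b, g, h, rfl⟩ | ⟨a, h, rfl⟩)
  · exact edge_mem_hyperplanesIn
      (mem_of_vanishing_le_ker_edgeForm h.ne.symm (hle.trans (ker_edgeForm_symm a b _).le))
      (mem_of_vanishing_le_ker_edgeForm h.ne hle) h
  · exact loop_mem_hyperplanesIn (mem_of_vanishing_le_ker_proj hle) h

theorem above_frameHyperplanes_sInf_hyperplanesIn (Γ : GainGraph V G) (U : Set V) :
    above Γ.frameHyperplanes (sInf (Γ.hyperplanesIn U)) = Γ.hyperplanesIn U :=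
  Set.Subset.antisymm
    (fun _ hH => mem_hyperplanesIn_of_vanishing_le hH.1
      ((Γ.vanishing_le_sInf_hyperplanesIn U).trans hH.2))
    fun _ hH => ⟨Γ.hyperplanesIn_subset U hH, sInf_le hH⟩

theorem image_comap_frameHyperplanes_induce (Γ : GainGraph V G) (U : Set V) :
    Submodule.comap (LinearMap.funLeft K K Subtype.val) '' (Γ.induce U).frameHyperplanes =
      Γ.hyperplanesIn U := by
  apply Set.Subset.antisymm
  · rintro _ ⟨H, ⟨a, b, g, hab, rfl⟩ | ⟨a, ha, rfl⟩, rfl⟩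
    · exact edge_mem_hyperplanesIn a.2 b.2 hab
    · exact loop_mem_hyperplanesIn a.2 ha
  · rintro H (⟨a, b, g, ha, hb, hab, rfl⟩ | ⟨a, ha, hl, rfl⟩)
    · exact ⟨_, edge_mem_frameHyperplanes (a := (⟨a, ha⟩ : U)) (b := ⟨b, hb⟩) hab, rfl⟩
    · exact ⟨_, loop_mem_frameHyperplanes (a := (⟨a, ha⟩ : U)) hl, rfl⟩

theorem IsFullClique.subset (h : Γ.IsFullClique W) (hU : U ⊆ W) : Γ.IsFullClique U :=
  ⟨fun a ha => h.loop a (hU ha), fun a ha b hb => h.edge a (hU ha) b (hU hb)⟩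

theorem IsFullClique.sInf_hyperplanesIn_le (h : Γ.IsFullClique W) (hWU : W ⊆ U) :
    sInf (Γ.hyperplanesIn U) ≤ vanishing K W :=
  le_iInf₂ fun a ha => sInf_le (loop_mem_hyperplanesIn (hWU ha) (h.loop a ha))

end HyperplanesIn

section Clique

variable {Γ : GainGraph V G} {W : Set V} {F : Submodule K (V → K)} {x : V → K}

theorem IsFullClique.mul_eq_mul_of_le_ker_edgeForm (hW : Γ.IsFullClique W)
    (hx : x ∈ sInf (above (Γ.hyperplanesIn W) F)) {a b b' : V} {g g' : G} (hb : b ∈ W)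
    (hb' : b' ∈ W) (h : F ≤ LinearMap.ker (edgeForm a b (g : Kˣ)))
    (h' : F ≤ LinearMap.ker (edgeForm a b' (g' : Kˣ))) :
    ((g : Kˣ) : K) * x b = ((g' : Kˣ) : K) * x b' := by
  rw [Submodule.mem_sInf] at hx
  obtain rfl | hbb := eq_or_ne b b'
  · obtain rfl | hgg := eq_or_ne g g'
    · rfl
    · have hxb : x b = 0 := hx _ ⟨loop_mem_hyperplanesIn hb (hW.loop b hb), (le_inf h h').trans
        (ker_edgeForm_inf_ker_edgeForm_le_ker_proj a b fun h0 => hgg (Subtype.ext h0))⟩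
      rw [hxb, mul_zero, mul_zero]
  · have hbF : F ≤ LinearMap.ker (edgeForm b b' ((g⁻¹ * g' : G) : Kˣ)) :=
      (le_inf (h.trans (ker_edgeForm_symm a b _).le) h').trans
        (ker_edgeForm_inf_ker_edgeForm_le b a b' _ _)
    have hxb := mem_ker_edgeForm.1
      (hx _ ⟨edge_mem_hyperplanesIn hb hb' (hW.edge b hb b' hb' hbb _), hbF⟩)
    rw [hxb, Subgroup.coe_mul, Subgroup.coe_inv, Units.val_mul, mul_assoc,
      Units.mul_inv_cancel_left]

theorem IsFullClique.exists_eq_mul_of_le_ker_edgeForm (hW : Γ.IsFullClique W)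
    (hx : x ∈ sInf (above (Γ.hyperplanesIn W) F)) (a : V) :
    ∃ c : K, (∀ b ∈ W, ∀ g : G, F ≤ LinearMap.ker (edgeForm a b (g : Kˣ)) → c = (g : Kˣ) * x b) ∧
      ((∀ b ∈ W, ∀ g : G, ¬ F ≤ LinearMap.ker (edgeForm a b (g : Kˣ))) → c = 0) := by
  by_cases htied : ∃ b ∈ W, ∃ g : G, F ≤ LinearMap.ker (edgeForm a b (g : Kˣ))
  · obtain ⟨b, hb, g, h⟩ := htied
    exact ⟨(g : Kˣ) * x b, fun b' hb' g' h' => hW.mul_eq_mul_of_le_ker_edgeForm hx hb hb' h h',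
      fun hfree => absurd h (hfree b hb g)⟩
  · push Not at htied
    exact ⟨0, fun b hb g h => absurd h (htied b hb g), fun _ => rfl⟩

/-- A full clique is modular. A vector `x` on `W` extends to a vector of the flat `F` by taking the
value `g x_b` at the vertices `a` where `F` imposes `x_a = g x_b` for some `b` in `W`, and zero at
the other vertices. -/
theorem IsFullClique.sInf_above_hyperplanesIn_le (hW : Γ.IsFullClique W)
    (hF : sInf (above Γ.frameHyperplanes F) ≤ F) :
    sInf (above (Γ.hyperplanesIn W) F) ≤ F ⊔ vanishing K W := by
  intro x hx
  choose y hy hy0 using hW.exists_eq_mul_of_le_ker_edgeForm hx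
  have hyW : ∀ b ∈ W, y b = x b := fun b hb => by
    simpa using hy b b hb 1 fun z _ => mem_ker_edgeForm.2 (by simp)
  suffices hyF : y ∈ F from Submodule.mem_sup.2
    ⟨y, hyF, x - y, mem_vanishing.2 fun b hb => by simp [hyW b hb], add_sub_cancel y x⟩
  refine hF (Submodule.mem_sInf.2 ?_)
  rintro H ⟨⟨a, b, k, -, rfl⟩ | ⟨a, -, rfl⟩, hFH⟩
  · rw [mem_ker_edgeForm]
    by_cases htied : ∃ c ∈ W, ∃ g : G, F ≤ LinearMap.ker (edgeForm b c (g : Kˣ))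
    · obtain ⟨c, hc, g, h⟩ := htied
      have hac : F ≤ LinearMap.ker (edgeForm a c ((k * g : G) : Kˣ)) :=
        (le_inf hFH h).trans (ker_edgeForm_inf_ker_edgeForm_le a b c _ _)
      rw [hy a c hc _ hac, hy b c hc g h, Subgroup.coe_mul, Units.val_mul, mul_assoc]
    · push Not at htied
      have hfree : ∀ c ∈ W, ∀ g : G, ¬ F ≤ LinearMap.ker (edgeForm a c (g : Kˣ)) := fun c hc g h =>
        htied c hc (k⁻¹ * g) ((le_inf (hFH.trans (ker_edgeForm_symm a b _).le) h).trans
          (ker_edgeForm_inf_ker_edgeForm_le b a c _ _))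
      rw [hy0 a hfree, hy0 b htied, mul_zero]
  · by_cases htied : ∃ c ∈ W, ∃ g : G, F ≤ LinearMap.ker (edgeForm a c (g : Kˣ))
    · obtain ⟨c, hc, g, h⟩ := htied
      have hFc : F ≤ LinearMap.ker (LinearMap.proj c) :=
        (le_inf h hFH).trans ((ker_edgeForm_inf_ker_proj a c _).le.trans inf_le_right)
      have hxc : x c = 0 :=
        Submodule.mem_sInf.1 hx _ ⟨loop_mem_hyperplanesIn hc (hW.loop c hc), hFc⟩
      rw [mem_ker_proj, hy a c hc g h, hxc, mul_zero]
    · push Not at htied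
      exact hy0 a htied

end Clique

namespace IsGlued

variable {Γ : GainGraph V G} {V₁ V₂ : Set V}

theorem symm (h : Γ.IsGlued V₁ V₂) : Γ.IsGlued V₂ V₁ :=
  ⟨by rw [Set.union_comm, h.union_eq], fun a b g hab => (h.edge a b g hab).symm,
    Set.inter_comm V₁ V₂ ▸ h.clique⟩

theorem hyperplanesIn_union (h : Γ.IsGlued V₁ V₂) :
    Γ.hyperplanesIn V₁ ∪ Γ.hyperplanesIn V₂ = Γ.frameHyperplanes := by
  refine Set.Subset.antisymm
    (Set.union_subset (Γ.hyperplanesIn_subset _) (Γ.hyperplanesIn_subset _)) ?_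
  rintro H (⟨a, b, g, hab, rfl⟩ | ⟨a, ha, rfl⟩)
  · exact (h.edge a b g hab).imp (fun h => edge_mem_hyperplanesIn h.1 h.2 hab)
      fun h => edge_mem_hyperplanesIn h.1 h.2 hab
  · have hV : a ∈ V₁ ∪ V₂ := h.union_eq ▸ Set.mem_univ a
    exact hV.imp (fun hV => loop_mem_hyperplanesIn hV ha) fun hV => loop_mem_hyperplanesIn hV ha

theorem sInf_inf_sInf (h : Γ.IsGlued V₁ V₂) :
    sInf (Γ.hyperplanesIn V₁) ⊓ sInf (Γ.hyperplanesIn V₂) = sInf Γ.frameHyperplanes := by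
  rw [← sInf_union, h.hyperplanesIn_union]

theorem sInf_sup_sInf (h : Γ.IsGlued V₁ V₂) :
    sInf (Γ.hyperplanesIn V₁) ⊔ sInf (Γ.hyperplanesIn V₂) = vanishing K (V₁ ∩ V₂) := by
  classical
  refine le_antisymm (sup_le (h.clique.sInf_hyperplanesIn_le Set.inter_subset_left)
    (h.clique.sInf_hyperplanesIn_le Set.inter_subset_right)) fun x hx => ?_
  rw [mem_vanishing] at hx
  refine Submodule.mem_sup.2 ⟨V₁.piecewise 0 x,
    Γ.vanishing_le_sInf_hyperplanesIn V₁ (mem_vanishing.2 fun a ha => by simp [ha]),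
    V₁.piecewise x 0, Γ.vanishing_le_sInf_hyperplanesIn V₂ (mem_vanishing.2 fun a ha => ?_), ?_⟩
  · by_cases ha' : a ∈ V₁
    · simpa [ha'] using hx a ⟨ha', ha⟩
    · simp [ha']
  · ext a
    by_cases ha : a ∈ V₁ <;> simp [ha]

theorem sInf_above_hyperplanesIn_le (h : Γ.IsGlued V₁ V₂) {F : Submodule K (V → K)}
    (hF : sInf (above Γ.frameHyperplanes F) ≤ F) :
    sInf (above (Γ.hyperplanesIn V₁) F) ≤ F ⊔ sInf (Γ.hyperplanesIn V₁) := by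
  classical
  intro x hx
  obtain ⟨y, hy, hyx⟩ : ∃ y ∈ F, ∀ a ∈ V₁ ∩ V₂, y a = x a := by
    have hsub : above (Γ.hyperplanesIn (V₁ ∩ V₂)) F ⊆ above (Γ.hyperplanesIn V₁) F :=
      fun H hH => ⟨Γ.hyperplanesIn_mono Set.inter_subset_left hH.1, hH.2⟩
    obtain ⟨y, hy, z, hz, rfl⟩ :=
      Submodule.mem_sup.1 (h.clique.sInf_above_hyperplanesIn_le hF (sInf_le_sInf hsub hx))
    exact ⟨y, hy, fun a ha => by simp [mem_vanishing.1 hz a ha]⟩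
  let z : V → K := V₁.piecewise x y
  have hzx : ∀ a ∈ V₁, z a = x a := fun a ha => V₁.piecewise_eq_of_mem _ _ ha
  have hzy : ∀ a ∈ V₂, z a = y a := by
    intro a ha
    by_cases ha' : a ∈ V₁
    · rw [hzx a ha', hyx a ⟨ha', ha⟩]
    · exact V₁.piecewise_eq_of_notMem _ _ ha'
  have hzF : z ∈ F := by
    refine hF (Submodule.mem_sInf.2 ?_)
    rintro H ⟨hH, hFH⟩
    rw [← h.hyperplanesIn_union] at hH
    rcases hH with hH | hH
    · exact (mem_congr_of_mem_hyperplanesIn hH hzx).2 (Submodule.mem_sInf.1 hx H ⟨hH, hFH⟩)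
    · exact (mem_congr_of_mem_hyperplanesIn hH hzy).2 (hFH hy)
  exact Submodule.mem_sup.2 ⟨z, hzF, x - z, Γ.vanishing_le_sInf_hyperplanesIn V₁
    (mem_vanishing.2 fun a ha => by simp [hzx a ha]), add_sub_cancel z x⟩

theorem isComplOver {w : Submodule K (V → K)} (h : Γ.IsGlued V₁ V₂)
    (hw : IsComplOver (sInf (Γ.hyperplanesIn V₂)) w (vanishing K (V₁ ∩ V₂))) :
    IsComplOver (sInf Γ.frameHyperplanes) w (sInf (Γ.hyperplanesIn V₁)) where
  sup_eq := by
    rw [← hw.sup_eq, ← h.sInf_sup_sInf, sup_left_comm, sup_eq_left.2 hw.le_left, sup_comm]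
  inf_eq := by
    rw [← h.sInf_inf_sInf, ← hw.inf_eq, inf_left_comm,
      inf_eq_left.2 (h.clique.sInf_hyperplanesIn_le Set.inter_subset_left)]

theorem subset_left_or_subset_right (h : Γ.IsGlued V₁ V₂) {W : Set V} (hW : Γ.IsFullClique W) :
    W ⊆ V₁ ∨ W ⊆ V₂ := by
  by_contra! hnot
  obtain ⟨⟨a, ha, ha₁⟩, b, hb, hb₂⟩ := hnot.imp Set.not_subset.1 Set.not_subset.1
  have hb₁ : b ∈ V₁ := (h.union_eq ▸ Set.mem_univ b : b ∈ V₁ ∪ V₂).resolve_right hb₂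
  have hab := h.edge a b 1 (hW.edge a ha b hb (ne_of_mem_of_not_mem hb₁ ha₁).symm 1)
  exact hab.elim (fun hab => ha₁ hab.1) fun hab => hb₂ hab.2

end IsGlued

section ComplementaryFlags

variable [Finite V] [Finite G] {Γ : GainGraph V G} {U V₁ V₂ W : Set V}

/-- The flats of the frame arrangement of `Γ`, as subspaces. -/
noncomputable abbrev flats (Γ : GainGraph V G) : Finset (Submodule K (V → K)) :=
  intersections Γ.finite_frameHyperplanes

/-- Every full clique `W` of `Γ` has a complementary flag: there is a divisional flag of the frame
arrangement that passes through a complement of `vanishing K W`. This strengthening of divisional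
freeness is preserved when gain graphs are glued along full cliques. -/
def HasComplementaryFlags (Γ : GainGraph V G) : Prop :=
  ∀ W, Γ.IsFullClique W →
    HasComplementaryFlag Γ.flats subspaceDim (sInf Γ.frameHyperplanes) (vanishing K W)

theorem HasComplementaryFlags.of_induce (h : (Γ.induce U).HasComplementaryFlags) (hWU : W ⊆ U)
    (hW : Γ.IsFullClique W) :
    HasComplementaryFlag Γ.flats subspaceDim (sInf (Γ.hyperplanesIn U)) (vanishing K W) := by
  let π : (V → K) →ₗ[K] (U → K) := LinearMap.funLeft K K Subtype.val
  have hπ : Function.Surjective π :=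
    LinearMap.funLeft_surjective_of_injective K K _ Subtype.val_injective
  let ι : Submodule K (U → K) ↪o Submodule K (V → K) :=
    OrderEmbedding.ofMapLEIff (Submodule.comap π)
      fun _ _ => Submodule.comap_le_comap_iff_of_surjective hπ
  have hι : ∀ B : Set (Submodule K (U → K)), ι (sInf B) = sInf (ι '' B) := fun B => by
    ext x
    simp [ι, Submodule.mem_sInf]
  have himage : ι '' (Γ.induce U).frameHyperplanes = Γ.hyperplanesIn U :=
    Γ.image_comap_frameHyperplanes_induce U
  have hbot : ι (sInf (Γ.induce U).frameHyperplanes) = sInf (Γ.hyperplanesIn U) := by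
    rw [hι, himage]
  have hclique : (Γ.induce U).IsFullClique (Subtype.val ⁻¹' W) :=
    ⟨fun a ha => hW.loop a ha,
      fun a ha b hb hab => hW.edge a ha b hb (Subtype.val_injective.ne hab)⟩
  have hvanishing : ι (vanishing K (Subtype.val ⁻¹' W : Set U)) = vanishing K W := by
    ext x
    exact ⟨fun hx => mem_vanishing.2 fun a ha => mem_vanishing.1 hx ⟨a, hWU ha⟩ ha,
      fun hx => mem_vanishing.2 fun a ha => mem_vanishing.1 hx a ha⟩
  have habove : above Γ.frameHyperplanes (ι (sInf (Γ.induce U).frameHyperplanes)) =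
      ι '' (Γ.induce U).frameHyperplanes := by
    rw [hbot, himage, Γ.above_frameHyperplanes_sInf_hyperplanesIn]
  rw [← hbot, ← hvanishing]
  exact (h _ hclique).map_intersections ι isRankFunction_subspaceDim isRankFunction_subspaceDim
    (subspaceDim_comap hπ) hι habove

theorem IsGlued.isModularElement (h : Γ.IsGlued V₁ V₂) :
    IsModularElement Γ.flats (sInf (Γ.hyperplanesIn V₁)) where
  mem := sInf_mem_intersections (Γ.hyperplanesIn_subset V₁)
  sup_mem F hF := by
    refine mem_intersections_iff_sInf_above_le.2 (le_trans ?_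
      (h.sInf_above_hyperplanesIn_le (mem_intersections_iff_sInf_above_le.1 hF)))
    exact sInf_le_sInf fun H hH => ⟨Γ.hyperplanesIn_subset V₁ hH.1, sup_le hH.2 (sInf_le hH.1)⟩

theorem IsGlued.isParallelConnection (h : Γ.IsGlued V₁ V₂) :
    IsParallelConnection Γ.flats (sInf (Γ.hyperplanesIn V₁)) (sInf (Γ.hyperplanesIn V₂)) where
  left := h.isModularElement
  right := h.symm.isModularElement
  inf_le F hF := by
    refine le_trans (le_sInf ?_) (mem_intersections_iff_sInf_above_le.1 hF)
    rintro H ⟨hH, hFH⟩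
    rw [← h.hyperplanesIn_union] at hH
    exact hH.elim (fun hH => inf_le_left.trans (sup_le hFH (sInf_le hH)))
      fun hH => inf_le_right.trans (sup_le hFH (sInf_le hH))

theorem IsGlued.divisionalChain_top {w : Submodule K (V → K)} (h : Γ.IsGlued V₁ V₂)
    (hw : IsComplOver (sInf (Γ.hyperplanesIn V₂)) w (vanishing K (V₁ ∩ V₂)))
    (hchain : DivisionalChain Γ.flats subspaceDim (sInf (Γ.hyperplanesIn V₂)) ⊤ w) :
    DivisionalChain Γ.flats subspaceDim (sInf Γ.frameHyperplanes) ⊤ w := by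
  rw [← h.sInf_inf_sInf]
  exact h.isParallelConnection.divisionalChain isRankFunction_subspaceDim
    (infClosed_intersections Γ.finite_frameHyperplanes) top_mem_intersections hw.le_left
    (h.isComplOver hw).sup_eq hchain

theorem IsGlued.hasComplementaryFlag_of_subset (h : Γ.IsGlued V₁ V₂)
    (h₁ : (Γ.induce V₁).HasComplementaryFlags) (h₂ : (Γ.induce V₂).HasComplementaryFlags)
    (hWV : W ⊆ V₁) (hW : Γ.IsFullClique W) :
    HasComplementaryFlag Γ.flats subspaceDim (sInf Γ.frameHyperplanes) (vanishing K W) := by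
  obtain ⟨w, hwS, hw, hchain, -⟩ := h₂.of_induce Set.inter_subset_right h.clique
  exact (h₁.of_induce hWV hW).of_isModularElement h.isModularElement isRankFunction_subspaceDim
    (infClosed_intersections Γ.finite_frameHyperplanes) top_mem_intersections hwS
    (h.isComplOver hw) (h.divisionalChain_top hw hchain)

theorem IsGlued.hasComplementaryFlags (h : Γ.IsGlued V₁ V₂)
    (h₁ : (Γ.induce V₁).HasComplementaryFlags) (h₂ : (Γ.induce V₂).HasComplementaryFlags) :
    Γ.HasComplementaryFlags := fun _ hW =>
  (h.subset_left_or_subset_right hW).elim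
    (fun hWV => h.hasComplementaryFlag_of_subset h₁ h₂ hWV hW)
    fun hWV => h.symm.hasComplementaryFlag_of_subset h₂ h₁ hWV hW

end ComplementaryFlags

end GainGraph

/-! ### Bias simplicial vertices -/

namespace GainGraph

variable {V : Type u} {K : Type v} [Field K] {G : Subgroup Kˣ} {Γ : GainGraph V G} {v : V}
  {W : Set V}

theorem edge_notMem_hyperplanesIn {a : V} {g : G} (h : Γ.Edge a v g) :
    LinearMap.ker (edgeForm a v (g : Kˣ)) ∉ Γ.hyperplanesIn {v}ᶜ := fun hmem =>
  mem_of_vanishing_le_ker_edgeForm h.ne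
    ((Γ.vanishing_le_sInf_hyperplanesIn _).trans (sInf_le hmem)) rfl

theorem loop_notMem_hyperplanesIn (Γ : GainGraph V G) (v : V) :
    LinearMap.ker (LinearMap.proj v : (V → K) →ₗ[K] K) ∉ Γ.hyperplanesIn {v}ᶜ := fun hmem =>
  mem_of_vanishing_le_ker_proj ((Γ.vanishing_le_sInf_hyperplanesIn _).trans (sInf_le hmem)) rfl

theorem eq_ker_of_notMem_hyperplanesIn {H : Submodule K (V → K)} (hH : H ∈ Γ.frameHyperplanes)
    (hH' : H ∉ Γ.hyperplanesIn {v}ᶜ) :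
    (∃ (a : V) (g : G), Γ.Edge a v g ∧ H = LinearMap.ker (edgeForm a v (g : Kˣ))) ∨
      (v ∈ Γ.Loops ∧ H = LinearMap.ker (LinearMap.proj v : (V → K) →ₗ[K] K)) := by
  rcases hH with (⟨a, b, g, hab, rfl⟩ | ⟨a, ha, rfl⟩)
  · obtain rfl | hbv := eq_or_ne b v
    · exact Or.inl ⟨a, g, hab, rfl⟩
    obtain rfl | hav := eq_or_ne a v
    · exact Or.inl ⟨b, g⁻¹, Γ.symm hab, by rw [ker_edgeForm_symm, Subgroup.coe_inv]⟩
    · exact absurd (edge_mem_hyperplanesIn hav hbv hab) hH'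
  · obtain rfl | hav := eq_or_ne a v
    · exact Or.inr ⟨ha, rfl⟩
    · exact absurd (loop_mem_hyperplanesIn hav ha) hH'

theorem IsFullClique.isGlued_compl_singleton (hW : Γ.IsFullClique W) (hvW : v ∈ W)
    (hadj : ∀ a g, Γ.Edge a v g → a ∈ W) :
    Γ.IsGlued W {v}ᶜ where
  union_eq := Set.eq_univ_of_forall fun a => (eq_or_ne a v).imp (by rintro rfl; exact hvW) id
  edge a b g hab := by
    obtain rfl | hbv := eq_or_ne b v
    · exact Or.inl ⟨hadj a g hab, hvW⟩
    obtain rfl | hav := eq_or_ne a v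
    · exact Or.inl ⟨hvW, hadj b _ (Γ.symm hab)⟩
    · exact Or.inr ⟨hav, hbv⟩
  clique := hW.subset Set.inter_subset_left

namespace IsBiasSimplicial

theorem exists_line (hv : Γ.IsBiasSimplicial v) {e f : Submodule K (V → K)}
    (he : e ∈ Γ.frameHyperplanes) (he' : e ∉ Γ.hyperplanesIn {v}ᶜ) (hf : f ∈ Γ.frameHyperplanes)
    (hf' : f ∉ Γ.hyperplanesIn {v}ᶜ) (hef : e ≠ f) :
    ∃ g ∈ Γ.hyperplanesIn {v}ᶜ, e ⊓ f ≤ g ∧ e ⊓ g ≤ f := by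
  rcases eq_ker_of_notMem_hyperplanesIn he he' with ⟨a, g, ha, rfl⟩ | ⟨hl, rfl⟩ <;>
  rcases eq_ker_of_notMem_hyperplanesIn hf hf' with ⟨b, k, hb, rfl⟩ | ⟨hl', rfl⟩
  · obtain rfl | hab := eq_or_ne a b
    · have hgk : (g : Kˣ) ≠ k := fun hgk => hef (by rw [hgk])
      refine ⟨_, loop_mem_hyperplanesIn ha.ne (hv.parallel ha hb (ne_of_apply_ne _ hgk)), ?_, ?_⟩
      · refine le_trans (le_inf inf_le_left
          (ker_edgeForm_inf_ker_edgeForm_le_ker_proj a v hgk)) ?_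
        exact (ker_edgeForm_inf_ker_proj a v _).ge.trans inf_le_right
      · refine (le_inf inf_le_right ?_).trans (ker_proj_inf_ker_proj_le a v _)
        exact (ker_edgeForm_inf_ker_proj a v _).le.trans inf_le_right
    · refine ⟨_, edge_mem_hyperplanesIn ha.ne hb.ne (hv.triangle hab ha (Γ.symm hb)), ?_, ?_⟩
      · exact (inf_le_inf_left _ (ker_edgeForm_symm b v _).le).trans
          (ker_edgeForm_inf_ker_edgeForm_le a v b _ _)
      · have hle := ker_edgeForm_inf_ker_edgeForm_le (K := K) b a v ((g * k⁻¹ : G) : Kˣ)⁻¹ g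
        rw [← ker_edgeForm_symm, inf_comm] at hle
        simpa using hle
  · exact ⟨_, loop_mem_hyperplanesIn ha.ne (hv.loop ha hl'),
      (ker_edgeForm_inf_ker_proj a v _).ge.trans inf_le_right,
      (ker_edgeForm_inf_ker_proj a v _).le.trans inf_le_right⟩
  · refine ⟨_, loop_mem_hyperplanesIn hb.ne (hv.loop hb hl), ?_, ?_⟩
    · rw [inf_comm]
      exact (ker_edgeForm_inf_ker_proj b v _).ge.trans inf_le_right
    · rw [inf_comm]
      exact ker_proj_inf_ker_proj_le b v _
  · exact absurd rfl hef

theorem isFullClique_insert (hv : Γ.IsBiasSimplicial v) (hW : Γ.IsFullClique W) (hvW : v ∈ W)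
    {a : V} {g : G} (ha : Γ.Edge a v g) (haW : a ∉ W) : Γ.IsFullClique (insert a (W \ {v})) := by
  have hab : ∀ b ∈ W \ {v}, ∀ k, Γ.Edge a b k := fun b hb k => by
    have := hv.triangle (ne_of_mem_of_not_mem hb.1 haW).symm ha
      (hW.edge v hvW b hb.1 (Ne.symm hb.2) (g⁻¹ * k))
    rwa [mul_inv_cancel_left] at this
  refine ⟨?_, ?_⟩
  · rintro b (rfl | hb)
    · exact hv.loop ha (hW.loop v hvW)
    · exact hW.loop b hb.1
  · rintro b (rfl | hb) c (rfl | hc) hbc k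
    · exact absurd rfl hbc
    · exact hab c hc k
    · simpa using Γ.symm (hab b hb k⁻¹)
    · exact hW.edge b hb.1 c hc.1 hbc k

variable [Finite V] [Finite G]

theorem isModularCoatomIn (hv : Γ.IsBiasSimplicial v) :
    IsModularCoatomIn subspaceDim (Γ.hyperplanesIn {v}ᶜ) Γ.frameHyperplanes where
  subset := Γ.hyperplanesIn_subset _
  rank_add_one _ hH := Γ.frameArrangement.subspaceDim_add_one hH
  not_le _ he he' hle := he' <|
    mem_hyperplanesIn_of_vanishing_le he ((Γ.vanishing_le_sInf_hyperplanesIn _).trans hle)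
  exists_line _ he he' _ hf hf' hef := hv.exists_line he he' hf hf' hef

theorem hasComplementaryFlag_of_notMem (hv : Γ.IsBiasSimplicial v)
    (h : (Γ.induce {v}ᶜ).HasComplementaryFlags) (hW : Γ.IsFullClique W) (hvW : v ∉ W) :
    HasComplementaryFlag Γ.flats subspaceDim (sInf Γ.frameHyperplanes) (vanishing K W) := by
  have hflag := h.of_induce (Set.subset_compl_singleton_iff.2 hvW) hW
  by_cases hex : ∃ e ∈ Γ.frameHyperplanes, e ∉ Γ.hyperplanesIn {v}ᶜ
  · obtain ⟨e, he, he'⟩ := hex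
    exact hv.isModularCoatomIn.hasComplementaryFlag isRankFunction_subspaceDim he he' hflag
  · push Not at hex
    rwa [(Γ.hyperplanesIn_subset {v}ᶜ).antisymm hex] at hflag

theorem hasComplementaryFlag_of_edge (hv : Γ.IsBiasSimplicial v)
    (h : (Γ.induce {v}ᶜ).HasComplementaryFlags) (hW : Γ.IsFullClique W) (hvW : v ∈ W) {a : V}
    {g : G} (ha : Γ.Edge a v g) (haW : a ∉ W) :
    HasComplementaryFlag Γ.flats subspaceDim (sInf Γ.frameHyperplanes) (vanishing K W) := by
  have he := edge_mem_frameHyperplanes ha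
  have hcoatom := isRankFunction_subspaceDim.isCoatom_of_add_one_eq
    (Γ.frameArrangement.subspaceDim_add_one he)
  have hnot : ¬ vanishing K W ≤ LinearMap.ker (edgeForm a v (g : Kˣ)) := fun hle =>
    haW (mem_of_vanishing_le_ker_edgeForm ha.ne.symm (hle.trans (ker_edgeForm_symm a v _).le))
  have hsub : insert a (W \ {v}) ⊆ {v}ᶜ :=
    Set.insert_subset ha.ne fun _ hb => hb.2
  refine hv.isModularCoatomIn.hasComplementaryFlag_of_inf_eq isRankFunction_subspaceDim he
    (edge_notMem_hyperplanesIn ha) (h.of_induce hsub (hv.isFullClique_insert hW hvW ha haW))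
    (hcoatom.2 _ (left_lt_sup.2 hnot)) ?_
  rw [← Set.insert_sdiff_self_of_mem hvW, vanishing_insert, vanishing_insert, ← inf_assoc,
    ← inf_assoc, ker_edgeForm_inf_ker_proj, Set.insert_sdiff_self_of_mem hvW]

theorem hasComplementaryFlag_of_forall_mem (hv : Γ.IsBiasSimplicial v)
    (h : (Γ.induce {v}ᶜ).HasComplementaryFlags) (hW : Γ.IsFullClique W) (hvW : v ∈ W)
    (hadj : ∀ a g, Γ.Edge a v g → a ∈ W) :
    HasComplementaryFlag Γ.flats subspaceDim (sInf Γ.frameHyperplanes) (vanishing K W) := by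
  have hm : IsModularCoatomIn subspaceDim (Γ.hyperplanesIn {v}ᶜ) Γ.frameHyperplanes :=
    hv.isModularCoatomIn
  have hd : IsRankFunction (subspaceDim : Submodule K (V → K) → ℕ) := isRankFunction_subspaceDim
  have hglue := hW.isGlued_compl_singleton hvW hadj
  have he := loop_mem_frameHyperplanes (hW.loop v hvW)
  have he' := Γ.loop_notMem_hyperplanesIn v
  obtain ⟨w, hwS, hw, htop, hbot⟩ := h.of_induce Set.inter_subset_right hglue.clique
  have hvanishing : vanishing K W =
      LinearMap.ker (LinearMap.proj v) ⊓ vanishing K (W ∩ {v}ᶜ) := by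
    rw [← vanishing_insert, ← Set.sdiff_eq, Set.insert_sdiff_self_of_mem hvW]
  have hlower := hm.divisionalChain_inf hd he he' hwS le_rfl hbot
  rw [(hm.isComplOver hd he he').inf_eq] at hlower
  refine ⟨w, hwS, ?_, hglue.divisionalChain_top hw htop,
    hlower.head (hm.divisionalStep_inf hd he he' hwS hw.le_left)⟩
  rw [hvanishing]
  exact ((hm.isComplOver hd he he').inf_left hw.symm).symm

theorem hasComplementaryFlags (hv : Γ.IsBiasSimplicial v)
    (h : (Γ.induce {v}ᶜ).HasComplementaryFlags) : Γ.HasComplementaryFlags := by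
  intro W hW
  by_cases hvW : v ∈ W
  · by_cases hex : ∃ a g, Γ.Edge a v g ∧ a ∉ W
    · obtain ⟨a, g, ha, haW⟩ := hex
      exact hv.hasComplementaryFlag_of_edge h hW hvW ha haW
    · push Not at hex
      exact hv.hasComplementaryFlag_of_forall_mem h hW hvW hex
  · exact hv.hasComplementaryFlag_of_notMem h hW hvW

end IsBiasSimplicial

end GainGraph

/-! ### Loopless gain graphs -/

namespace GainGraph

section LooplessGraph

variable {V K W : Type*} [Field K] {G : Subgroup Kˣ} {Γ : GainGraph V G} {S : Set V} {n : ℕ}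

theorem IsIso.loops_eq_empty {H : Subgroup G} (h : Γ.IsIso (complete n H)) : Γ.Loops = ∅ := by
  obtain ⟨σ, -, hloops⟩ := h
  exact Set.eq_empty_of_forall_notMem fun a ha => (hloops a).1 ha

theorem IsIso.edge_complete_iff {H : Subgroup G} (h : Γ.IsIso (complete n H)) {a b : V} {g : G} :
    Γ.Edge a b g ↔ a ≠ b ∧ g ∈ H := by
  obtain ⟨σ, hedge, -⟩ := h
  exact (hedge a b g).trans (and_congr_left' σ.injective.ne_iff)

theorem IsIso.natCard_eq {H : Subgroup G} (h : Γ.IsIso (complete n H)) : Nat.card V = n := by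
  obtain ⟨σ, -⟩ := h
  rw [Nat.card_congr σ, Nat.card_fin]

theorem isFullClique_of_isIso (h : (Γ.induce S).IsIso (completeWithLoops n G)) :
    Γ.IsFullClique S := by
  obtain ⟨σ, hedge, hloops⟩ := h
  refine ⟨fun a ha => (hloops ⟨a, ha⟩).2 trivial, fun a ha b hb hab g =>
    (hedge ⟨a, ha⟩ ⟨b, hb⟩ g).2 fun h => hab ?_⟩
  exact congrArg Subtype.val (σ.injective h)

theorem coe_eq_of_mem_signSubgroup {g : Kˣ} (hg : g ∈ signSubgroup K) :
    (g : K) = 1 ∨ (g : K) = -1 := by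
  obtain rfl | rfl := hg
  · exact .inl Units.val_one
  · exact .inr (by rw [Units.val_neg, Units.val_one])

theorem eq_one_of_mem_signSubgroup (h2 : (2 : K) = 0) {g : Kˣ} (hg : g ∈ signSubgroup K) :
    g = 1 := by
  refine Units.ext ((coe_eq_of_mem_signSubgroup hg).elim id fun h => ?_)
  rw [h, Units.val_one]
  linear_combination -h2

theorem ker_edgeForm_one (a b : V) :
    LinearMap.ker (edgeForm a b 1) =
      LinearMap.ker ((LinearMap.proj a : (V → K) →ₗ[K] K) - LinearMap.proj b) := by
  rw [edgeForm, Units.val_one, one_smul]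

theorem frameHyperplanes_eq_graphicHyperplanes (hloops : Γ.Loops = ∅) {H : SimpleGraph W}
    {φ : W → (V → K) →ₗ[K] K}
    (hedge : ∀ a b g, Γ.Edge a b g → ∃ c d, H.Adj c d ∧
      LinearMap.ker (edgeForm a b (g : Kˣ)) = LinearMap.ker (φ c - φ d))
    (hadj : ∀ c d, H.Adj c d → ∃ a b g, Γ.Edge a b g ∧
      LinearMap.ker (edgeForm a b (g : Kˣ)) = LinearMap.ker (φ c - φ d)) :
    Γ.frameHyperplanes = graphicHyperplanes H φ Set.univ := by
  ext P
  constructor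
  · rintro (⟨a, b, g, hab, rfl⟩ | ⟨a, ha, rfl⟩)
    · obtain ⟨c, d, hcd, hker⟩ := hedge a b g hab
      exact ⟨c, trivial, d, trivial, hcd, hker⟩
    · exact absurd (hloops ▸ ha) (Set.notMem_empty a)
  · rintro ⟨c, -, d, -, hcd, rfl⟩
    obtain ⟨a, b, g, hab, hker⟩ := hadj c d hcd
    exact hker ▸ edge_mem_frameHyperplanes hab

variable [Finite V] [Finite G]

theorem hasComplementaryFlags_of_divisionalChain (hloops : Γ.Loops = ∅)
    (h : DivisionalChain Γ.flats subspaceDim (sInf Γ.frameHyperplanes) ⊤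
      (sInf Γ.frameHyperplanes)) : Γ.HasComplementaryFlags := by
  intro W hW
  obtain rfl : W = ∅ :=
    Set.eq_empty_of_forall_notMem fun a ha => Set.notMem_empty a (hloops ▸ hW.loop a ha)
  have hvanishing : vanishing K (∅ : Set V) = ⊤ := by simp [vanishing]
  rw [hvanishing]
  exact ⟨_, sInf_mem_intersections subset_rfl, ⟨sup_top_eq _, inf_top_eq _⟩, h, .refl⟩

theorem hasComplementaryFlags_of_isEmpty [IsEmpty V] (Γ : GainGraph V G) :
    Γ.HasComplementaryFlags := by
  refine hasComplementaryFlags_of_divisionalChain (Set.eq_empty_of_isEmpty _) ?_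
  rw [show sInf Γ.frameHyperplanes = ⊤ from Subsingleton.elim _ _]

theorem IsIso.hasComplementaryFlags_completeTwo (h : Γ.IsIso (complete 2 (⊤ : Subgroup G))) :
    Γ.HasComplementaryFlags := by
  refine hasComplementaryFlags_of_divisionalChain h.loops_eq_empty
    (divisionalChain_of_inf_le isRankFunction_subspaceDim
      (fun H hH => Γ.frameArrangement.subspaceDim_add_one hH) ?_)
  obtain ⟨p, q, hpq, hV⟩ := Nat.card_eq_two_iff.1 h.natCard_eq
  have hform : ∀ H ∈ Γ.frameHyperplanes, ∃ g : Kˣ, H = LinearMap.ker (edgeForm p q g) := by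
    rintro H (⟨a, b, g, hab, rfl⟩ | ⟨a, ha, rfl⟩)
    · have hmem (c : V) : c = p ∨ c = q := hV.ge (Set.mem_univ c)
      obtain rfl | rfl := hmem a <;> obtain rfl | rfl := hmem b
      · exact absurd rfl hab.ne
      · exact ⟨g, rfl⟩
      · exact ⟨_, ker_edgeForm_symm _ _ _⟩
      · exact absurd rfl hab.ne
    · exact absurd (h.loops_eq_empty ▸ ha) (Set.notMem_empty a)
  intro e he f hf H hH hef
  obtain ⟨g, rfl⟩ := hform e he
  obtain ⟨k, rfl⟩ := hform f hf
  obtain ⟨l, rfl⟩ := hform H hH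
  have hgk : g ≠ k := by
    rintro rfl
    exact hef rfl
  have hproj := ker_edgeForm_inf_ker_edgeForm_le_ker_proj (K := K) p q hgk
  calc LinearMap.ker (edgeForm (K := K) p q g) ⊓ LinearMap.ker (edgeForm p q k)
      ≤ LinearMap.ker (edgeForm p q g) ⊓ LinearMap.ker (LinearMap.proj q) :=
        le_inf inf_le_left hproj
    _ ≤ LinearMap.ker (LinearMap.proj p) ⊓ LinearMap.ker (LinearMap.proj q) :=
        le_inf ((ker_edgeForm_inf_ker_proj p q g).ge.trans inf_le_right) inf_le_right
    _ ≤ LinearMap.ker (edgeForm p q l) := ker_proj_inf_ker_proj_le p q l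

theorem hasComplementaryFlags_of_frameHyperplanes_eq [Finite W] (hloops : Γ.Loops = ∅)
    {H : SimpleGraph W} {φ : W → (V → K) →ₗ[K] K} (hφ : IsSeparatedFamily φ)
    (hH : HasSimplicialVertices H)
    (hframe : Γ.frameHyperplanes = graphicHyperplanes H φ Set.univ) :
    Γ.HasComplementaryFlags := by
  have := Fintype.ofFinite W
  rw [← Finset.coe_univ] at hframe
  have hchain : ∀ h : Γ.frameHyperplanes.Finite, DivisionalChain (intersections h) subspaceDim
      (sInf Γ.frameHyperplanes) ⊤ (sInf Γ.frameHyperplanes) := by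
    rw [hframe]
    exact divisionalChain_graphicHyperplanes hφ hH _
  exact hasComplementaryFlags_of_divisionalChain hloops (hchain _)

theorem hasComplementaryFlags_of_forall_edge_eq_one (hloops : Γ.Loops = ∅)
    (hgain : ∀ {a b g}, Γ.Edge a b g → g = 1) (hΓ : HasSimplicialVertices Γ.positivePart) :
    Γ.HasComplementaryFlags := by
  classical
  have hseparated : IsSeparatedFamily fun a : V => (LinearMap.proj a : (V → K) →ₗ[K] K) :=
    fun a => ⟨Pi.single a 1, 0, by simp, fun b hb => by simp [Pi.single_eq_of_ne hb]⟩
  refine hasComplementaryFlags_of_frameHyperplanes_eq hloops hseparated hΓ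
    (frameHyperplanes_eq_graphicHyperplanes hloops (fun a b g hab => ?_)
      fun a b hab => ⟨a, b, 1, hab, by simp [edgeForm]⟩)
  obtain rfl := hgain hab
  exact ⟨a, b, hab, by simp [edgeForm]⟩

end LooplessGraph

section SignedCompleteThree

variable {V K : Type*} [Field K] {G : Subgroup Kˣ} {Γ : GainGraph V G}

theorem exists_ne_and_ne_of_card_eq_three [Fintype V] (hV : Fintype.card V = 3) (a b : V) :
    ∃ k, k ≠ a ∧ k ≠ b := by
  classical
  obtain ⟨k, -, hk⟩ := Finset.exists_mem_notMem_of_card_lt_card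
    (s := {a, b}) (t := Finset.univ) (Finset.card_le_two.trans_lt (by simp [hV]))
  exact ⟨k, by simpa using hk⟩

theorem exists_pair_ne_of_card_eq_three [Fintype V] (hV : Fintype.card V = 3) (k : V) :
    ∃ a b, a ≠ b ∧ a ≠ k ∧ b ≠ k := by
  obtain ⟨a, hak, -⟩ := exists_ne_and_ne_of_card_eq_three hV k k
  obtain ⟨b, hba, hbk⟩ := exists_ne_and_ne_of_card_eq_three hV a k
  exact ⟨a, b, hba.symm, hak, hbk⟩

variable (K) in
/-- The linear form `0`, and the forms `s - x_k` on `K^V`, where `s` is the sum of all coordinates.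
For three vertices, their differences cut out the arrangement of `K₃^{±1}` as the graphic
arrangement of the complete graph on four vertices: the root systems `D₃` and `A₃` agree. -/
def coordSumSub [Fintype V] : Option V → (V → K) →ₗ[K] K
  | none => 0
  | some k => ∑ a, LinearMap.proj a - LinearMap.proj k

theorem coordSumSub_apply [Fintype V] (hV : Fintype.card V = 3) {a b k : V} (hab : a ≠ b)
    (hak : a ≠ k) (hbk : b ≠ k) (x : V → K) : coordSumSub K (some k) x = x a + x b := by
  classical
  have huniv : ({a, b, k} : Finset V) = Finset.univ :=
    Finset.eq_univ_of_card _ (by rw [Finset.card_eq_three.2 ⟨a, b, k, hab, hak, hbk, rfl⟩, hV])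
  rw [coordSumSub, ← huniv, Finset.sum_insert (by simp [hab, hak]), Finset.sum_pair hbk,
    ← add_assoc, add_sub_cancel_right, LinearMap.add_apply, LinearMap.proj_apply,
    LinearMap.proj_apply]

theorem ker_coordSumSub_sub [Fintype V] (a b : V) :
    LinearMap.ker (coordSumSub K (some b) - coordSumSub K (some a)) =
      LinearMap.ker (edgeForm a b 1) := by
  rw [ker_edgeForm_one, coordSumSub, coordSumSub, sub_sub_sub_cancel_left]

theorem ker_coordSumSub_sub_none [Fintype V] (hV : Fintype.card V = 3) {a b k : V} (hab : a ≠ b)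
    (hak : a ≠ k) (hbk : b ≠ k) :
    LinearMap.ker (coordSumSub K (some k) - coordSumSub K none) =
      LinearMap.ker (edgeForm a b (-1)) := by
  ext x
  rw [mem_ker_edgeForm, coordSumSub, sub_zero, LinearMap.mem_ker,
    coordSumSub_apply hV hab hak hbk, Units.val_neg, Units.val_one, neg_one_mul,
    eq_neg_iff_add_eq_zero]

theorem isSeparatedFamily_coordSumSub [Fintype V] (hV : Fintype.card V = 3) (h2 : (2 : K) ≠ 0) :
    IsSeparatedFamily (coordSumSub K : Option V → (V → K) →ₗ[K] K) := by
  classical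
  rintro (_ | k)
  · refine ⟨1, 2, h2.symm, ?_⟩
    rintro (_ | k) hk
    · exact absurd rfl hk
    · obtain ⟨a, b, hab, hak, hbk⟩ := exists_pair_ne_of_card_eq_three hV k
      rw [coordSumSub_apply hV hab hak hbk, Pi.one_apply, Pi.one_apply, one_add_one_eq_two]
  · refine ⟨Function.update 1 k (-1), 0, ?_, ?_⟩
    · obtain ⟨a, b, hab, hak, hbk⟩ := exists_pair_ne_of_card_eq_three hV k
      rwa [coordSumSub_apply hV hab hak hbk, Function.update_of_ne hak, Function.update_of_ne hbk,
        Pi.one_apply, Pi.one_apply, one_add_one_eq_two]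
    · rintro (_ | l) hl
      · rfl
      · have hkl : k ≠ l := fun h => hl (congrArg some h.symm)
        obtain ⟨m, hmk, hml⟩ := exists_ne_and_ne_of_card_eq_three hV k l
        rw [coordSumSub_apply hV hmk.symm hkl hml, Function.update_self,
          Function.update_of_ne hmk, Pi.one_apply, neg_add_cancel]

variable [Finite V] [Finite G]

theorem IsIso.hasComplementaryFlags_signedCompleteThree (hG : signSubgroup K ≤ G)
    (h : Γ.IsIso (complete 3 ((signSubgroup K).subgroupOf G))) : Γ.HasComplementaryFlags := by
  have hloops := h.loops_eq_empty
  have hpos {a b : V} (hab : a ≠ b) : Γ.Edge a b 1 :=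
    h.edge_complete_iff.2 ⟨hab, one_mem _⟩
  have hneg {a b : V} (hab : a ≠ b) : Γ.Edge a b ⟨-1, hG (.inr rfl)⟩ :=
    h.edge_complete_iff.2 ⟨hab, .inr rfl⟩
  by_cases h2 : (2 : K) = 0
  · have htop : Γ.positivePart = ⊤ := top_le_iff.1 fun a b hab => hpos hab
    exact hasComplementaryFlags_of_forall_edge_eq_one hloops
      (fun hab => Subtype.ext (eq_one_of_mem_signSubgroup h2 (h.edge_complete_iff.1 hab).2))
      (htop ▸ hasSimplicialVertices_top)
  let _ := Fintype.ofFinite V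
  have hV : Fintype.card V = 3 := Nat.card_eq_fintype_card.symm.trans h.natCard_eq
  refine hasComplementaryFlags_of_frameHyperplanes_eq hloops (isSeparatedFamily_coordSumSub hV h2)
    hasSimplicialVertices_top (frameHyperplanes_eq_graphicHyperplanes hloops ?_ ?_)
  · intro a b g hab
    obtain ⟨hne, hg⟩ := h.edge_complete_iff.1 hab
    obtain hg | hg : (g : Kˣ) = 1 ∨ (g : Kˣ) = -1 := hg
    · exact ⟨some b, some a, by simpa using hne.symm, by rw [hg, ker_coordSumSub_sub]⟩
    · obtain ⟨k, hka, hkb⟩ := exists_ne_and_ne_of_card_eq_three hV a b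
      exact ⟨some k, none, by simp,
        by rw [hg, ker_coordSumSub_sub_none hV hne hka.symm hkb.symm]⟩
  · rintro (_ | k) (_ | l) hkl
    · exact absurd rfl hkl
    · obtain ⟨a, b, hab, hal, hbl⟩ := exists_pair_ne_of_card_eq_three hV l
      exact ⟨a, b, _, hneg hab, by rw [ker_sub_comm, ker_coordSumSub_sub_none hV hab hal hbl]⟩
    · obtain ⟨a, b, hab, hak, hbk⟩ := exists_pair_ne_of_card_eq_three hV k
      exact ⟨a, b, _, hneg hab, (ker_coordSumSub_sub_none hV hab hak hbk).symm⟩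
    · exact ⟨l, k, 1, hpos fun h => hkl (congrArg some h.symm), (ker_coordSumSub_sub l k).symm⟩

end SignedCompleteThree

section ChordalWithNegativeStar

variable {V K : Type*} [Field K] {G : Subgroup Kˣ} {Γ : GainGraph V G} {c : V}

variable (K) in
/-- The coordinates on `K^V` together with the form `-x_c`. A negative edge `{a, c}` gives the
hyperplane `x_a = -x_c`, so that a star of negative edges around `c` can be replaced by positive
edges to a new vertex `none`. -/
def coordNeg (c : V) : Option V → (V → K) →ₗ[K] K
  | none => -LinearMap.proj c
  | some a => LinearMap.proj a

theorem ker_coordNeg_sub_none (a c : V) :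
    LinearMap.ker (coordNeg K c (some a) - coordNeg K c none) =
      LinearMap.ker (edgeForm a c (-1)) := by
  ext x
  rw [mem_ker_edgeForm, Units.val_neg, Units.val_one, neg_one_mul]
  exact sub_eq_zero

theorem isSeparatedFamily_coordNeg (h2 : (2 : K) ≠ 0) (c : V) :
    IsSeparatedFamily (coordNeg K c) := by
  classical
  have hneg : (-1 : K) ≠ 1 := fun h => h2 (by linear_combination -h)
  rintro (_ | a)
  · refine ⟨1, 1, hneg, ?_⟩
    rintro (_ | b) hb
    · exact absurd rfl hb
    · rfl
  have hne {b : V} (hb : some b ≠ some a) : b ≠ a := fun h => hb (congrArg some h)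
  obtain rfl | hac := eq_or_ne a c
  · refine ⟨Function.update 1 a (-1), 1, by simpa [coordNeg] using hneg, ?_⟩
    rintro (_ | b) hb
    · simp [coordNeg]
    · simp [coordNeg, Function.update_of_ne (hne hb)]
  · refine ⟨Pi.single a 1, 0, by simp [coordNeg], ?_⟩
    rintro (_ | b) hb
    · simp [coordNeg, Pi.single_eq_of_ne hac.symm]
    · simp [coordNeg, Pi.single_eq_of_ne (hne hb)]

variable [Finite V] [Finite G]

theorem IsChordalWithNegativeStar.hasComplementaryFlags {hG : signSubgroup K ≤ G}
    (h : Γ.IsChordalWithNegativeStar hG) : Γ.HasComplementaryFlags := by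
  have hchordal := hasSimplicialVertices_of_isChordalGraph h.chordal
  by_cases h2 : (2 : K) = 0
  · exact hasComplementaryFlags_of_forall_edge_eq_one h.loopless
      (fun hab => Subtype.ext (eq_one_of_mem_signSubgroup h2 (h.gain_mem _ _ _ hab))) hchordal
  obtain ⟨c, S, -, hstar, hclique⟩ := h.star
  refine hasComplementaryFlags_of_frameHyperplanes_eq h.loopless (isSeparatedFamily_coordNeg h2 c)
    (hchordal.adjoinVertex (S := S) fun a ha b hb => hclique a ha b hb)
    (frameHyperplanes_eq_graphicHyperplanes h.loopless ?_ ?_)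
  · intro a b g hab
    obtain hg | hg : (g : Kˣ) = 1 ∨ (g : Kˣ) = -1 := h.gain_mem a b g hab
    · obtain rfl : g = 1 := Subtype.ext hg
      exact ⟨some a, some b, hab, ker_edgeForm_one a b⟩
    · obtain rfl : g = ⟨-1, hG (.inr rfl)⟩ := Subtype.ext hg
      obtain ⟨rfl, hb⟩ | ⟨rfl, ha⟩ := (hstar a b).1 hab
      · exact ⟨some b, none, hb, by
          rw [ker_edgeForm_symm, ker_coordNeg_sub_none, inv_neg, inv_one]⟩
      · exact ⟨some a, none, ha, (ker_coordNeg_sub_none a b).symm⟩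
  · rintro (_ | a) (_ | b) hab
    · exact absurd hab id
    · exact ⟨b, c, _, (hstar b c).2 (.inr ⟨rfl, hab⟩), by
        rw [ker_sub_comm, ker_coordNeg_sub_none]⟩
    · exact ⟨a, c, _, (hstar a c).2 (.inr ⟨rfl, hab⟩), (ker_coordNeg_sub_none a c).symm⟩
    · exact ⟨a, b, 1, hab, ker_edgeForm_one a b⟩

end ChordalWithNegativeStar

end GainGraph

theorem FrameClass.hasComplementaryFlags {K : Type v} [Field K] {G : Subgroup Kˣ} [Finite G]
    {V : Type u} [Finite V] {Γ : GainGraph V G} (hΓ : FrameClass G Γ) :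
    Γ.HasComplementaryFlags := by
  induction hΓ with
  | null Γ => exact Γ.hasComplementaryFlags_of_isEmpty
  | completeTwo Γ h => exact h.hasComplementaryFlags_completeTwo
  | signedCompleteThree hG Γ h => exact h.hasComplementaryFlags_signedCompleteThree hG
  | chordalWithNegativeStar hG Γ h => exact h.hasComplementaryFlags
  | biasSimplicial Γ v hv _ ih => exact hv.hasComplementaryFlags ih
  | glue Γ V₁ V₂ n hV _ _ hE hn ih₁ ih₂ =>
    exact GainGraph.IsGlued.hasComplementaryFlags
      ⟨hV, hE, GainGraph.isFullClique_of_isIso hn⟩ ih₁ ih₂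

theorem mainTheorem3 {K : Type v} [Field K] (G : Subgroup Kˣ) [Finite G]
    {V : Type u} [Finite V] (Γ : GainGraph V G) (hΓ : FrameClass G Γ) :
    Γ.frameArrangement.IsDivisionallyFree := by
  obtain ⟨w, -, -, htop, hbot⟩ := hΓ.hasComplementaryFlags ∅ ⟨by simp, by simp⟩
  exact Γ.frameArrangement.isDivisionallyFree_of_divisionalChain (htop.trans hbot)
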